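/- Let $k$ be an algebraically closed field of characteristic $0$ and let $H$ be a finite-dimensional Hopf algebra over $k$ with antipode $S$. For a Hopf algebra $A$, write $G(A)$ for the group of group-like elements of $A$ and, for $g\in G(A)$ of finite order, $\langle g\rangle\subseteq A$ for the linear span of the powers of $g$. The dual $H^*$ has the convolution product $(fg)(h)=\sum f(h_{(1)})g(h_{(2)})$ and the comultiplication determined by $\sum f_{(1)}(a)f_{(2)}(b)=f(ab)$. The Drinfeld double $D(H)$ is $(H^*)^{cop}\otimes H$ as a coalgebra, with product $$(f\otimes h)(g\otimes l)=\sum f\,[h_{(1)}\rightharpoonup g\leftharpoonup S^{-1}(h_{(3)})]\otimes h_{(2)}l,\qquad \langle a\rightharpoonup g\leftharpoonup b,c\rangle=\langle g,bca\rangle ;$$ one writes $fh$ for $f\otimes h$. Its standard universal $R$-matrix is $\mathcal R=\sum_i (1\otimes h_i)\otimes(h^i\otimes 1)$, where $(h_i)$ is any basis of $H$ and $(h^i)$ is the dual basis of $H^*$. A Hopf subalgebra $K$ of a Hopf algebra $A$ is normal if $\sum h_{(1)}yS(h_{(2)})\in K$ and $\sum S(h_{(1)})yh_{(2)}\in K$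 for all $h\in A$, $y\in K$; put $K^+=K\cap\ker\varepsilon$. A quasitriangular Hopf algebra $(A,R)$ is a Hopf algebra $A$ with an invertible $R\in A\otimes A$ such that $(\Delta\otimes\mathrm{id})(R)=R_{13}R_{23}$, $(\mathrm{id}\otimes\Delta)(R)=R_{13}R_{12}$ and $\Delta^{op}(h)R=R\Delta(h)$ for all $h\in A$. It is factorizable if moreover the map $A^*\to A$, $p\mapsto(p\otimes\mathrm{id})(R_{21}R)$, is a linear isomorphism. **Corollary.** Let $n$ be an odd positive integer and let $x\in G(H)$ have order $n$. Suppose that there are $m\ge 0$, elements $a_1,\dots,a_m\in H$, a group-like element $\chi\in G(H^*)$ and permutations $\sigma,\tau\in S_m$ such that (i) $xa_i=a_{\sigma(i)}x$ for all $i$, and the family $(a_ix^j)_{1\le i\le m,\,1\le j\le n}$ is a linear basis of $H$; (ii) if $(E_{a_ix^j})$ denotes the dual basis of $H^*$, then, in $H^*$, $$\chi E_{a_ix^j}=\chi(x)^jE_{a_{\tau(i)}x^j}\quad\text{and}\quad E_{a_ix^j}\chi=\chi(x)^jE_{a_{\sigma(\tau(i))}x^j}\qquad(1\le i\le m,\ 1\le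 j\le n);$$ (iii) $\chi(x)$ is a primitive $n$-th root of unity and $\chi$ has order $n$. Then $\chi x$ is a group-like element of $D(H)$, $\langle\chi x\rangle$ is a normal Hopf subalgebra of $D(H)$, the left ideal $I=D(H)\langle\chi x\rangle^+$ is a two-sided Hopf ideal, and $(D(H)/I,\overline{\mathcal R})$ is a factorizable Hopf algebra, where $\overline{\mathcal R}$ is the image of $\mathcal R$ in $D(H)/I\otimes D(H)/I$. -/

import Mathlib

open scoped TensorProduct
open WithConv

namespace HopfDouble
noncomputable section
open TensorProduct Coalgebra
set_option linter.unusedSimpArgs false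
set_option linter.unusedSectionVars false

section Antipode
variable (k : Type*) {H : Type*} [Field k] [Ring H] [HopfAlgebra k H]
open HopfAlgebra

theorem comul_comp_antipode : (comul : H →ₗ[k] H ⊗[k] H) ∘ₗ antipode k =
    TensorProduct.map (antipode k) (antipode k) ∘ₗ (TensorProduct.comm k H H).toLinearMap ∘ₗ
      comul := by
  refine (toConv_injective ?_).symm
  refine left_inv_eq_right_inv (a := toConv (comul : H →ₗ[k] H ⊗[k] H)) ?_
    LinearMap.comul_right_inv
  apply WithConv.ext
  rw [LinearMap.convMul_def, LinearMap.convOne_def]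
  simp only
  let M : H ⊗[k] H →ₗ[k] H := LinearMap.mul' k H ∘ₗ TensorProduct.map (antipode k) LinearMap.id
  have hM : M ∘ₗ comul = Algebra.linearMap k H ∘ₗ counit := mul_antipode_rTensor_comul
  let L := (TensorProduct.leftComm k H (H ⊗[k] H) H).toLinearMap
  have h1 : LinearMap.mul' k (H ⊗[k] H) ∘ₗ TensorProduct.map
        (TensorProduct.map (antipode k) (antipode k) ∘ₗ (TensorProduct.comm k H H).toLinearMap)
        LinearMap.id = TensorProduct.map M M ∘ₗ L ∘ₗ
          LinearMap.lTensor H (TensorProduct.assoc k H H H).symm.toLinearMap ∘ₗ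
          (TensorProduct.assoc k H H (H ⊗[k] H)).toLinearMap := by
    ext; simp [M, L]
  have h2 : LinearMap.lTensor H (TensorProduct.assoc k H H H).symm.toLinearMap ∘ₗ
      (TensorProduct.assoc k H H (H ⊗[k] H)).toLinearMap ∘ₗ TensorProduct.map comul comul ∘ₗ (comul : H →ₗ[k] H ⊗[k] H) =
      TensorProduct.map LinearMap.id (TensorProduct.map (comul : H →ₗ[k] H ⊗[k] H) LinearMap.id) ∘ₗ
        TensorProduct.map LinearMap.id comul ∘ₗ (comul : H →ₗ[k] H ⊗[k] H) := by
    simp only [coassoc_simps]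
  have h3 : TensorProduct.map M M ∘ₗ L ∘ₗ
      TensorProduct.map LinearMap.id (TensorProduct.map (comul : H →ₗ[k] H ⊗[k] H) LinearMap.id) =
      TensorProduct.map (Algebra.linearMap k H) M ∘ₗ
        (TensorProduct.leftComm k H k H).toLinearMap ∘ₗ
        TensorProduct.map LinearMap.id (TensorProduct.map counit LinearMap.id) := by
    ext a b c
    have := LinearMap.congr_fun hM b
    simp only [LinearMap.comp_apply] at this
    simp [L, this]
  calc _ = (LinearMap.mul' k (H ⊗[k] H) ∘ₗ TensorProduct.map
        (TensorProduct.map (antipode k) (antipode k) ∘ₗ (TensorProduct.comm k H H).toLinearMap)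
        LinearMap.id) ∘ₗ TensorProduct.map comul comul ∘ₗ (comul : H →ₗ[k] H ⊗[k] H) := by
        simp only [coassoc_simps]
    _ = TensorProduct.map M M ∘ₗ L ∘ₗ (LinearMap.lTensor H (TensorProduct.assoc k H H H).symm.toLinearMap ∘ₗ
      (TensorProduct.assoc k H H (H ⊗[k] H)).toLinearMap ∘ₗ TensorProduct.map comul comul ∘ₗ (comul : H →ₗ[k] H ⊗[k] H)) := by
        rw [h1]; rfl
    _ = (TensorProduct.map M M ∘ₗ L ∘ₗ
      TensorProduct.map LinearMap.id (TensorProduct.map (comul : H →ₗ[k] H ⊗[k] H) LinearMap.id)) ∘ₗ 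
        TensorProduct.map LinearMap.id comul ∘ₗ (comul : H →ₗ[k] H ⊗[k] H) := by rw [h2]; rfl
    _ = _ := by
      rw [h3]
      ext h
      have e1 : ∀ u : H, TensorProduct.map counit LinearMap.id (comul u) = (1 : k) ⊗ₜ[k] u :=
        fun u => rTensor_counit_comul u
      have e2 := LinearMap.congr_fun hM h
      simp only [LinearMap.comp_apply] at e2 ⊢
      rw [← (ℛ k h).eq] at e2 ⊢
      simp only [map_sum, TensorProduct.map_tmul, LinearMap.id_apply, e1,
        LinearEquiv.coe_coe, TensorProduct.leftComm_tmul, ← TensorProduct.tmul_sum, e2]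
      simp [Algebra.algebraMap_eq_smul_one, Algebra.TensorProduct.one_def]

/-- The antipode of a finite-dimensional Hopf algebra is bijective. -/
theorem antipode_bijective [FiniteDimensional k H] :
    Function.Bijective (antipode k : H →ₗ[k] H) := by
  let P : Submodule k H := LinearMap.range (antipode k : H →ₗ[k] H)
  have hmul : ∀ u v, u ∈ P → v ∈ P → u * v ∈ P := by
    rintro _ _ ⟨u, rfl⟩ ⟨v, rfl⟩
    exact ⟨v * u, antipode_mul_antidistrib v u⟩
  let B : Subalgebra k (WithConv (H →ₗ[k] H)) :=
    { carrier := {f | ∀ h, f h ∈ P}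
      mul_mem' := by
        intro f g hf hg h
        rw [(ℛ k h).convMul_apply]
        exact P.sum_mem fun i _ => hmul _ _ (hf _) (hg _)
      add_mem' := fun hf hg h => P.add_mem (hf h) (hg h)
      algebraMap_mem' := by
        intro r h
        rw [LinearMap.convAlgebraMap_apply, Algebra.algebraMap_eq_smul_one]
        exact P.smul_mem _ (P.smul_mem _ ⟨1, antipode_one⟩) }
  let s : B := ⟨toConv (antipode k), fun h => ⟨h, rfl⟩⟩
  have e : FiniteDimensional k (WithConv (H →ₗ[k] H)) :=
    (WithConv.linearEquiv k (H →ₗ[k] H)).symm.finiteDimensional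
  have h1 : (toConv LinearMap.id : WithConv (H →ₗ[k] H)) * (s : WithConv (H →ₗ[k] H)) = 1 := LinearMap.id_mul_antipode
  have hinj : Function.Injective (LinearMap.mulLeft k s) := by
    intro f g hfg
    apply Subtype.ext
    have := congrArg (fun z : B => (toConv LinearMap.id : WithConv (H →ₗ[k] H)) * (z : WithConv (H →ₗ[k] H))) hfg
    simpa [← mul_assoc, h1] using this
  obtain ⟨b, hb⟩ := LinearMap.injective_iff_surjective.1 hinj 1
  have hb' : (b : WithConv (H →ₗ[k] H)) = toConv LinearMap.id := by
    have : (s : WithConv (H →ₗ[k] H)) * b = 1 := congrArg Subtype.val hb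
    calc (b : WithConv (H →ₗ[k] H)) = ((toConv LinearMap.id : WithConv (H →ₗ[k] H)) * (s : WithConv (H →ₗ[k] H))) * b := by rw [h1, one_mul]
      _ = toConv LinearMap.id := by rw [mul_assoc, this, mul_one]
  have hsurj : Function.Surjective (antipode k : H →ₗ[k] H) := by
    intro h
    have := b.2 h
    rw [hb'] at this
    exact this
  exact ⟨LinearMap.injective_iff_surjective.2 hsurj, hsurj⟩

/-- The composition inverse of the antipode of a finite-dimensional Hopf algebra. -/
def antipodeInv [FiniteDimensional k H] : H →ₗ[k] H :=
  (LinearEquiv.ofBijective (antipode k : H →ₗ[k] H) (antipode_bijective k)).symm.toLinearMap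

variable [FiniteDimensional k H]

@[simp] theorem antipode_antipodeInv (h : H) : antipode k (antipodeInv k h) = h :=
  (LinearEquiv.ofBijective (antipode k : H →ₗ[k] H) (antipode_bijective k)).apply_symm_apply h

@[simp] theorem antipodeInv_antipode (h : H) : antipodeInv k (antipode k h) = h :=
  (LinearEquiv.ofBijective (antipode k : H →ₗ[k] H) (antipode_bijective k)).symm_apply_apply h

theorem antipodeInv_mul (a b : H) : antipodeInv k (a * b) = antipodeInv k b * antipodeInv k a := by
  apply (antipode_bijective k).1
  simp [antipode_mul_antidistrib]

@[simp] theorem antipodeInv_one : antipodeInv k (1 : H) = 1 := by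
  apply (antipode_bijective k).1
  simp

theorem comul_antipodeInv (h : H) : comul (antipodeInv k h) =
    TensorProduct.map (antipodeInv k) (antipodeInv k)
      (TensorProduct.comm k H H (comul (R := k) h)) := by
  have h1 := LinearMap.congr_fun (comul_comp_antipode k) (antipodeInv k h)
  simp only [LinearMap.comp_apply, antipode_antipodeInv, LinearEquiv.coe_coe] at h1
  have h2 : TensorProduct.map (antipodeInv k) (antipodeInv k) ∘ₗ
      TensorProduct.map (antipode k : H →ₗ[k] H) (antipode k : H →ₗ[k] H) = LinearMap.id := by
    ext; simp
  rw [h1, ← TensorProduct.map_comm, ← LinearMap.comp_apply (TensorProduct.map _ _), h2]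
  simp

theorem mul_comm_antipodeInv_left (h : H) :
    LinearMap.mul' k H (TensorProduct.map LinearMap.id (antipodeInv k)
      (TensorProduct.comm k H H (comul (R := k) h))) = algebraMap k H (counit h) := by
  apply (antipode_bijective k).1
  have := sum_mul_antipode_eq_algebraMap_counit (ℛ k h)
  rw [← (ℛ k h).eq]
  simp [antipode_mul_antidistrib, this, Algebra.algebraMap_eq_smul_one]

theorem mul_comm_antipodeInv_right (h : H) :
    LinearMap.mul' k H (TensorProduct.map (antipodeInv k) LinearMap.id
      (TensorProduct.comm k H H (comul (R := k) h))) = algebraMap k H (counit h) := by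
  apply (antipode_bijective k).1
  have := sum_antipode_mul_eq_algebraMap_counit (ℛ k h)
  rw [← (ℛ k h).eq]
  simp [antipode_mul_antidistrib, this, Algebra.algebraMap_eq_smul_one]

end Antipode
section Cop
/-- The co-opposite coalgebra: the same module, with the opposite comultiplication. -/
def Cop (C : Type*) : Type _ := C

variable (k C : Type*) [Field k] [AddCommGroup C] [Module k C] [Coalgebra k C]

instance : AddCommGroup (Cop C) := inferInstanceAs (AddCommGroup C)
instance : Module k (Cop C) := inferInstanceAs (Module k C)

instance : Coalgebra k (Cop C) where
  comul := ((TensorProduct.comm k C C).toLinearMap ∘ₗ (comul : C →ₗ[k] C ⊗[k] C) :)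
  counit := ((counit : C →ₗ[k] k) :)
  coassoc := by
    change (TensorProduct.assoc k C C C).toLinearMap ∘ₗ
      LinearMap.rTensor C ((TensorProduct.comm k C C).toLinearMap ∘ₗ comul) ∘ₗ
        (TensorProduct.comm k C C).toLinearMap ∘ₗ comul =
      LinearMap.lTensor C ((TensorProduct.comm k C C).toLinearMap ∘ₗ comul) ∘ₗ
        (TensorProduct.comm k C C).toLinearMap ∘ₗ comul
    have h1 : (TensorProduct.assoc k C C C).toLinearMap ∘ₗ
      LinearMap.rTensor C ((TensorProduct.comm k C C).toLinearMap) ∘ₗ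
        (TensorProduct.comm k (C) (C ⊗[k] C)).toLinearMap =
        LinearMap.lTensor C ((TensorProduct.comm k C C).toLinearMap) ∘ₗ
        (TensorProduct.comm k (C ⊗[k] C) C).toLinearMap ∘ₗ
         (TensorProduct.assoc k C C C).symm.toLinearMap := by
      ext; simp
    calc _ = ((TensorProduct.assoc k C C C).toLinearMap ∘ₗ
      LinearMap.rTensor C ((TensorProduct.comm k C C).toLinearMap) ∘ₗ
        (TensorProduct.comm k (C) (C ⊗[k] C)).toLinearMap) ∘ₗ LinearMap.lTensor C comul ∘ₗ comul := by
          simp only [coassoc_simps]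
      _ = _ := by rw [h1]; simp only [coassoc_simps]
  rTensor_counit_comp_comul := by
    change LinearMap.rTensor C counit ∘ₗ (TensorProduct.comm k C C).toLinearMap ∘ₗ comul = _
    have : LinearMap.rTensor C (counit (R := k)) ∘ₗ (TensorProduct.comm k C C).toLinearMap =
      (TensorProduct.comm k C k).toLinearMap ∘ₗ LinearMap.lTensor C (counit (R := k)) := by
      ext; simp
    rw [← LinearMap.comp_assoc, this, LinearMap.comp_assoc, lTensor_counit_comp_comul]
    rfl
  lTensor_counit_comp_comul := by
    change LinearMap.lTensor C counit ∘ₗ (TensorProduct.comm k C C).toLinearMap ∘ₗ comul = _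
    have : LinearMap.lTensor C (counit (R := k)) ∘ₗ (TensorProduct.comm k C C).toLinearMap =
      (TensorProduct.comm k k C).toLinearMap ∘ₗ LinearMap.rTensor C (counit (R := k)) := by
      ext; simp
    rw [← LinearMap.comp_assoc, this, LinearMap.comp_assoc, rTensor_counit_comp_comul]
    rfl
end Cop

/-- The dual of a Hopf algebra, with the convolution product
`(f * g)(h) = ∑ f(h₍₁₎) g(h₍₂₎)`. -/
abbrev HopfDual (k H : Type*) [Field k] [AddCommGroup H] [Module k H] : Type _ :=
  WithConv (H →ₗ[k] k)

section Dual
variable (k H : Type*) [Field k] [Ring H] [Algebra k H] [FiniteDimensional k H]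

instance : FiniteDimensional k (HopfDual k H) :=
  (WithConv.linearEquiv k (H →ₗ[k] k)).symm.finiteDimensional

variable {H} in
/-- `f ⊗ y ↦ f(x) y`. -/
def evalDual {N : Type*} [AddCommGroup N] [Module k N] (x : H) :
    HopfDual k H ⊗[k] N →ₗ[k] N :=
  (TensorProduct.lid k N).toLinearMap ∘ₗ LinearMap.rTensor N
    (LinearMap.applyₗ x ∘ₗ (WithConv.linearEquiv k (H →ₗ[k] k)).toLinearMap)

@[simp] theorem evalDual_tmul {N : Type*} [AddCommGroup N] [Module k N] (x : H)
    (f : HopfDual k H) (y : N) : evalDual k x (f ⊗ₜ[k] y) = f x • y := by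
  simp [evalDual]

variable {H} in
theorem evalDual_ext {N : Type*} [AddCommGroup N] [Module k N] {v w : HopfDual k H ⊗[k] N}
    (h : ∀ x, evalDual k x v = evalDual k x w) : v = w := by
  apply (TensorProduct.congr (WithConv.linearEquiv k (H →ₗ[k] k)) (LinearEquiv.refl k N)).injective
  have hinj : Function.Injective (dualTensorHom k H N) := by
    exact (dualTensorHomEquiv k H N).injective
  apply hinj
  ext x
  have key : ∀ u : HopfDual k H ⊗[k] N, dualTensorHom k H N (TensorProduct.congr
      (WithConv.linearEquiv k (H →ₗ[k] k)) (LinearEquiv.refl k N) u) x = evalDual k x u := by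
    intro u
    induction u with
    | zero => simp
    | tmul f y => simp
    | add a b ha hb => simp only [map_add, LinearMap.add_apply, ha, hb]
  rw [key, key, h]

/-- The identification `H* ⊗ H* ≃ (H ⊗ H)*`, `(f ⊗ g)(x ⊗ y) = f(x) g(y)`. -/
def dualPairing : HopfDual k H ⊗[k] HopfDual k H ≃ₗ[k] Module.Dual k (H ⊗[k] H) :=
  (TensorProduct.congr (WithConv.linearEquiv k (H →ₗ[k] k))
      (WithConv.linearEquiv k (H →ₗ[k] k))).trans (TensorProduct.dualDistribEquiv k H H)

/-- The comultiplication of the dual: `f ↦ f₍₁₎ ⊗ f₍₂₎` with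
`f(x y) = f₍₁₎(x) f₍₂₎(y)`. -/
def comulDual : HopfDual k H →ₗ[k] HopfDual k H ⊗[k] HopfDual k H :=
  (dualPairing k H).symm.toLinearMap ∘ₗ (LinearMap.mul' k H).dualMap ∘ₗ
    (WithConv.linearEquiv k (H →ₗ[k] k)).toLinearMap

/-- The counit of the dual: evaluation at `1`. -/
def counitDual : HopfDual k H →ₗ[k] k :=
  LinearMap.applyₗ (1 : H) ∘ₗ (WithConv.linearEquiv k (H →ₗ[k] k)).toLinearMap

@[simp] theorem counitDual_apply (f : HopfDual k H) : counitDual k H f = f 1 := rfl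

variable {H}

theorem dualPairing_apply (w : HopfDual k H ⊗[k] HopfDual k H) (x y : H) :
    dualPairing k H w (x ⊗ₜ y) = (evalDual k x w) y := by
  induction w with
  | zero => simp
  | tmul f y =>
    simp only [evalDual_tmul, ofConv_smul, LinearMap.smul_apply, smul_eq_mul]
    exact TensorProduct.dualDistrib_apply _ _ _ _
  | add a b ha hb => simp only [map_add, LinearMap.add_apply, ha, hb, ofConv_add]

theorem evalDual_comulDual (f : HopfDual k H) (x y : H) :
    (evalDual k x (comulDual k H f)) y = f (x * y) := by
  rw [← dualPairing_apply]
  simp [comulDual]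

theorem evalDual_lTensor {N N' : Type*} [AddCommGroup N] [Module k N] [AddCommGroup N']
    [Module k N'] (g : N →ₗ[k] N') (x : H) (w : HopfDual k H ⊗[k] N) :
    evalDual k x (LinearMap.lTensor (HopfDual k H) g w) = g (evalDual k x w) := by
  induction w with
  | zero => simp
  | tmul f y => simp
  | add a b ha hb => simp only [map_add, ha, hb]

theorem evalDual_assoc_rTensor_comulDual {N : Type*} [AddCommGroup N] [Module k N] (x y : H)
    (w : HopfDual k H ⊗[k] N) :
    evalDual k y (evalDual k x (TensorProduct.assoc k _ _ _
      (LinearMap.rTensor N (comulDual k H) w))) = evalDual k (x * y) w := by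
  induction w with
  | zero => simp
  | tmul f n =>
    rw [LinearMap.rTensor_tmul, evalDual_tmul, ← evalDual_comulDual]
    induction comulDual k H f with
    | zero => simp
    | tmul f g => simp [smul_smul]
    | add a b ha hb =>
      simp only [map_add, ha, hb, TensorProduct.add_tmul, ofConv_add, LinearMap.add_apply, add_smul]
  | add a b ha hb => simp only [map_add, ha, hb]

/-- The dual coalgebra of a finite-dimensional algebra: `⟨f₍₁₎, x⟩ ⟨f₍₂₎, y⟩ = ⟨f, x y⟩` and
`ε(f) = f(1)`. -/
instance : Coalgebra k (HopfDual k H) where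
  comul := comulDual k H
  counit := counitDual k H
  coassoc := by
    ext1 f
    refine evalDual_ext k fun x => evalDual_ext k fun y => ?_
    apply WithConv.ext
    ext z
    simp only [LinearMap.comp_apply, LinearEquiv.coe_coe]
    rw [evalDual_assoc_rTensor_comulDual, evalDual_lTensor, evalDual_comulDual,
      evalDual_comulDual, evalDual_comulDual, mul_assoc]
  rTensor_counit_comp_comul := by
    ext1 f
    simp only [LinearMap.comp_apply]
    have key : ∀ w : HopfDual k H ⊗[k] HopfDual k H,
        LinearMap.rTensor _ (counitDual k H) w = 1 ⊗ₜ evalDual k 1 w := by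
      intro w
      induction w with
      | zero => simp
      | tmul f g =>
        rw [LinearMap.rTensor_tmul, evalDual_tmul, ← TensorProduct.smul_tmul]
        simp
      | add a b ha hb => simp only [map_add, ha, hb, TensorProduct.tmul_add]
    rw [key, TensorProduct.mk_apply]
    congr 1
    apply WithConv.ext
    ext x
    rw [evalDual_comulDual, one_mul]
  lTensor_counit_comp_comul := by
    ext1 f
    refine evalDual_ext k fun x => ?_
    simp only [LinearMap.comp_apply]
    rw [evalDual_lTensor, counitDual_apply, evalDual_comulDual]
    simp

theorem comul_dual_def (f : HopfDual k H) : comul (R := k) f = comulDual k H f := rfl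

theorem counit_dual_def (f : HopfDual k H) : counit (R := k) f = f 1 := rfl

end Dual

section Double
variable (k H : Type*) [Field k] [Ring H] [HopfAlgebra k H] [FiniteDimensional k H]

variable {H} in
/-- `hit a c g = a ⇀ g ↼ S⁻¹(c)`, that is `⟨hit a c g, y⟩ = ⟨g, S⁻¹(c) y a⟩`. -/
def hit : H →ₗ[k] H →ₗ[k] HopfDual k H →ₗ[k] HopfDual k H :=
  LinearMap.mk₂ k
    (fun a c => (WithConv.linearEquiv k (H →ₗ[k] k)).symm.toLinearMap ∘ₗ
      (LinearMap.mulRight k a ∘ₗ LinearMap.mulLeft k (antipodeInv k c)).dualMap ∘ₗ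
        (WithConv.linearEquiv k (H →ₗ[k] k)).toLinearMap)
    (fun a a' c => by ext g y; simp [mul_add])
    (fun r a c => by ext g y; simp)
    (fun a c c' => by ext g y; simp [add_mul])
    (fun r a c => by ext g y; simp)

@[simp] theorem hit_apply (a c : H) (g : HopfDual k H) (y : H) :
    hit k a c g y = g (antipodeInv k c * y * a) := rfl

/-- `cross N g (a ⊗ n ⊗ c) = (a ⇀ g ↼ S⁻¹(c)) ⊗ n`. -/
def cross (N : Type*) [AddCommGroup N] [Module k N] :
    HopfDual k H →ₗ[k] H ⊗[k] (N ⊗[k] H) →ₗ[k] HopfDual k H ⊗[k] N :=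
  (LinearMap.lcomp k _ ((TensorProduct.assoc k H H N).symm.toLinearMap ∘ₗ
      LinearMap.lTensor H (TensorProduct.comm k N H).toLinearMap)) ∘ₗ
    LinearMap.rTensorHom N ∘ₗ (TensorProduct.lift (hit k (H := H))).flip

@[simp] theorem cross_tmul (N : Type*) [AddCommGroup N] [Module k N] (g : HopfDual k H)
    (a : H) (n : N) (c : H) : cross k H N g (a ⊗ₜ (n ⊗ₜ c)) = hit k a c g ⊗ₜ n := by
  simp [cross]

/-- `h ↦ h₍₁₎ ⊗ h₍₂₎ ⊗ h₍₃₎`. -/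
def comul₃ : H →ₗ[k] H ⊗[k] (H ⊗[k] H) := LinearMap.lTensor H comul ∘ₗ comul

/-- `h ⊗ g ↦ (h₍₁₎ ⇀ g ↼ S⁻¹(h₍₃₎)) ⊗ h₍₂₎`. -/
def straighten : H →ₗ[k] HopfDual k H →ₗ[k] HopfDual k H ⊗[k] H :=
  (cross k H H).flip ∘ₗ comul₃ k H

theorem straighten_apply (h : H) (g : HopfDual k H) :
    straighten k H h g = cross k H H g (comul₃ k H h) := rfl

/-- The product on `H* ⊗ H`:
`(f ⊗ h)(g ⊗ l) = ∑ f (h₍₁₎ ⇀ g ↼ S⁻¹(h₍₃₎)) ⊗ h₍₂₎ l`. -/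
def doubleMul : HopfDual k H ⊗[k] H →ₗ[k] HopfDual k H ⊗[k] H →ₗ[k] HopfDual k H ⊗[k] H :=
  TensorProduct.lift <| LinearMap.mk₂ k
    (fun f h => TensorProduct.lift <| LinearMap.mk₂ k
      (fun g l => TensorProduct.map (LinearMap.mulLeft k f) (LinearMap.mulRight k l)
        (straighten k H h g))
      (fun g g' l => by simp only [map_add])
      (fun r g l => by simp only [map_smul])
      (fun g l l' => by
        rw [show LinearMap.mulRight k (l + l') = LinearMap.mulRight k l + LinearMap.mulRight k l'
          from by ext; simp [mul_add], TensorProduct.map_add_right, LinearMap.add_apply])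
      (fun r g l => by
        rw [show LinearMap.mulRight k (r • l) = r • LinearMap.mulRight k l
          from by ext; simp, TensorProduct.map_smul_right, LinearMap.smul_apply]))
    (fun f f' h => by
      ext1; ext1 g; ext1 l
      simp only [TensorProduct.AlgebraTensorModule.curry_apply, LinearMap.restrictScalars_self, TensorProduct.curry_apply, TensorProduct.lift.tmul, LinearMap.mk₂_apply, LinearMap.add_apply]
      rw [show LinearMap.mulLeft k (f + f') = LinearMap.mulLeft k f + LinearMap.mulLeft k f'
          from by ext1; simp [add_mul], TensorProduct.map_add_left, LinearMap.add_apply])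
    (fun r f h => by
      ext1; ext1 g; ext1 l
      simp only [TensorProduct.AlgebraTensorModule.curry_apply, LinearMap.restrictScalars_self, TensorProduct.curry_apply, TensorProduct.lift.tmul, LinearMap.mk₂_apply, LinearMap.smul_apply]
      rw [show LinearMap.mulLeft k (r • f) = r • LinearMap.mulLeft k f
          from by ext1; simp, TensorProduct.map_smul_left, LinearMap.smul_apply])
    (fun f h h' => by
      ext1; ext1 g; ext1 l
      simp only [TensorProduct.AlgebraTensorModule.curry_apply, LinearMap.restrictScalars_self, TensorProduct.curry_apply, TensorProduct.lift.tmul, LinearMap.mk₂_apply, LinearMap.add_apply, map_add])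
    (fun r f h => by
      ext1; ext1 g; ext1 l
      simp only [TensorProduct.AlgebraTensorModule.curry_apply, LinearMap.restrictScalars_self, TensorProduct.curry_apply, TensorProduct.lift.tmul, LinearMap.mk₂_apply, LinearMap.smul_apply, map_smul])

theorem doubleMul_tmul (f g : HopfDual k H) (h l : H) :
    doubleMul k H (f ⊗ₜ h) (g ⊗ₜ l) =
      TensorProduct.map (LinearMap.mulLeft k f) (LinearMap.mulRight k l)
        (straighten k H h g) := by
  simp [doubleMul]



theorem straighten_one_left (g : HopfDual k H) : straighten k H 1 g = g ⊗ₜ 1 := by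
  rw [straighten_apply, comul₃]
  simp only [LinearMap.comp_apply, Bialgebra.comul_one, Algebra.TensorProduct.one_def,
    LinearMap.lTensor_tmul, cross_tmul]
  congr 1
  ext y
  simp

theorem straighten_one_right (h : H) : straighten k H h 1 = 1 ⊗ₜ h := by
  have h0 : ∀ a c : H, hit k a c 1 = (counit (R := k) a * counit (R := k) c) • 1 := by
    intro a c
    ext y
    have : counit (R := k) (antipodeInv k c) = counit (R := k) c := by
      rw [← HopfAlgebra.counit_antipode (R := k) (antipodeInv k c), antipode_antipodeInv]
    simp [this]
    ring
  have h1 : cross k H H 1 = TensorProduct.mk k (HopfDual k H) H 1 ∘ₗ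
      (TensorProduct.lid k H).toLinearMap ∘ₗ LinearMap.lTensor k (TensorProduct.rid k H).toLinearMap
      ∘ₗ LinearMap.lTensor k (LinearMap.lTensor H counit) ∘ₗ LinearMap.rTensor _ counit := by
    refine TensorProduct.ext' fun a t => ?_
    induction t with
    | zero => simp
    | tmul b c => simp [h0, TensorProduct.smul_tmul, smul_smul, mul_comm]
    | add a b ha hb => simp only [map_add, TensorProduct.tmul_add, ha, hb]
  rw [straighten_apply, comul₃, h1]
  simp only [LinearMap.comp_apply]
  rw [← LinearMap.comp_apply (LinearMap.rTensor _ counit), LinearMap.rTensor_comp_lTensor,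
    ← LinearMap.lTensor_comp_rTensor, LinearMap.comp_apply, rTensor_counit_comul]
  simp

theorem straighten_mul_left (h l : H) (p : HopfDual k H) :
    straighten k H (h * l) p = doubleMul k H (1 ⊗ₜ h) (straighten k H l p) := by
  let D₃ : H →ₐ[k] H ⊗[k] (H ⊗[k] H) :=
    (Algebra.TensorProduct.map (AlgHom.id k H) (Bialgebra.comulAlgHom k H)).comp
      (Bialgebra.comulAlgHom k H)
  have hD : ∀ x, comul₃ k H x = D₃ x := fun x => rfl
  have key : ∀ (a b c : H) (u : H ⊗[k] (H ⊗[k] H)), cross k H H p (u * (a ⊗ₜ (b ⊗ₜ c))) =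
      TensorProduct.map (LinearMap.mulLeft k 1) (LinearMap.mulRight k b)
        (cross k H H (hit k a c p) u) := by
    intro a b c u
    induction u with
    | zero => simp
    | add u v hu hv => simp only [map_add, add_mul, hu, hv]
    | tmul a' t =>
      induction t with
      | zero => simp
      | add u v hu hv => simp only [map_add, add_mul, TensorProduct.tmul_add, hu, hv]
      | tmul b' c' =>
        simp only [Algebra.TensorProduct.tmul_mul_tmul, cross_tmul, TensorProduct.map_tmul,
          LinearMap.mulRight_apply, LinearMap.mulLeft_apply, one_mul]
        congr 1
        ext y
        simp [antipodeInv_mul, mul_assoc]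
  rw [straighten_apply, hD, map_mul, straighten_apply, ← hD, ← hD]
  induction comul₃ k H l with
  | zero => simp
  | add u v hu hv => simp only [map_add, mul_add, hu, hv]
  | tmul a t =>
    induction t with
    | zero => simp
    | add u v hu hv => simp only [map_add, mul_add, TensorProduct.tmul_add, hu, hv]
    | tmul b c => rw [key, cross_tmul, doubleMul_tmul, straighten_apply]

/-- `mulLeftFactor N (f ⊗ (g ⊗ n)) = f g ⊗ n`. -/
def mulLeftFactor (N : Type*) [AddCommGroup N] [Module k N] :
    HopfDual k H ⊗[k] (HopfDual k H ⊗[k] N) →ₗ[k] HopfDual k H ⊗[k] N :=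
  LinearMap.rTensor N (LinearMap.mul' k (HopfDual k H)) ∘ₗ
    (TensorProduct.assoc k (HopfDual k H) (HopfDual k H) N).symm.toLinearMap

@[simp] theorem mulLeftFactor_tmul (N : Type*) [AddCommGroup N] [Module k N]
    (f g : HopfDual k H) (n : N) : mulLeftFactor k H N (f ⊗ₜ (g ⊗ₜ n)) = (f * g) ⊗ₜ n := by
  simp [mulLeftFactor]

theorem hit_mul (a c : H) (g p : HopfDual k H) {ι κ : Type*} (A : Coalgebra.Repr k a ι)
    (C : Coalgebra.Repr k c κ) : hit k a c (g * p) =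
    ∑ i ∈ A.index, ∑ j ∈ C.index, hit k (A.left i) (C.right j) g *
      hit k (A.right i) (C.left j) p := by
  ext y
  simp only [hit_apply, LinearMap.convMul_apply, Bialgebra.comul_mul, comul_antipodeInv,
    ofConv_sum, LinearMap.coe_sum, Finset.sum_apply]
  simp only [← A.eq, ← C.eq, ← (ℛ k y).eq, map_sum, Finset.sum_mul, Finset.mul_sum,
    TensorProduct.comm_tmul, TensorProduct.map_tmul, Algebra.TensorProduct.tmul_mul_tmul,
    LinearMap.mul'_apply, hit_apply]
  exact Finset.sum_congr rfl fun i _ => Finset.sum_comm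

theorem straighten_mul_right (h : H) (g p : HopfDual k H) :
    straighten k H h (g * p) = mulLeftFactor k H H
      (LinearMap.lTensor _ ((straighten k H).flip p) (straighten k H h g)) := by
  let E : H ⊗[k] ((H ⊗[k] (H ⊗[k] H)) ⊗[k] H) →ₗ[k] HopfDual k H ⊗[k] H :=
    mulLeftFactor k H H ∘ₗ cross k H (HopfDual k H ⊗[k] H) g ∘ₗ
      LinearMap.lTensor H (LinearMap.rTensor H (cross k H H p))
  have h1 : mulLeftFactor k H H ∘ₗ (LinearMap.lTensor _ ((straighten k H).flip p)) ∘ₗ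
      cross k H H g = E ∘ₗ LinearMap.lTensor H (LinearMap.rTensor H (comul₃ k H)) := by
    ext1; ext1 a; ext1; ext1 b; ext1 c
    simp [E, straighten_apply]
  have h2 : cross k H H (g * p) = E ∘ₗ 
      (LinearMap.lTensor H ((TensorProduct.assoc k H (H ⊗[k] H) H).symm.toLinearMap ∘ₗ
        LinearMap.lTensor H (TensorProduct.assoc k H H H).symm.toLinearMap) ∘ₗ
      (TensorProduct.assoc k H H _).toLinearMap ∘ₗ
      TensorProduct.map comul (TensorProduct.map LinearMap.id comul)) := by
    ext1; ext1 a; ext1; ext1 b; ext1 c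
    simp only [TensorProduct.AlgebraTensorModule.curry_apply, LinearMap.restrictScalars_self,
      TensorProduct.curry_apply, cross_tmul, LinearMap.comp_apply, TensorProduct.map_tmul,
      LinearMap.id_apply, hit_mul k H a c g p (ℛ k a) (ℛ k c)]
    rw [← (ℛ k a).eq, ← (ℛ k c).eq]
    simp [E, TensorProduct.sum_tmul, TensorProduct.tmul_sum]
    exact Finset.sum_comm
  have h3 : (LinearMap.lTensor H ((TensorProduct.assoc k H (H ⊗[k] H) H).symm.toLinearMap ∘ₗ
        LinearMap.lTensor H (TensorProduct.assoc k H H H).symm.toLinearMap) ∘ₗ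
      (TensorProduct.assoc k H H _).toLinearMap ∘ₗ
      TensorProduct.map comul (TensorProduct.map LinearMap.id comul)) ∘ₗ comul₃ k H =
      LinearMap.lTensor H (LinearMap.rTensor H (comul₃ k H)) ∘ₗ comul₃ k H := by
    unfold comul₃
    simp only [coassoc_simps]
  have h1' := LinearMap.congr_fun h1 (comul₃ k H h)
  have h3' := LinearMap.congr_fun h3 h
  simp only [LinearMap.comp_apply] at h1' h3'
  rw [straighten_apply, straighten_apply, h1', h2, ← h3']
  rfl

theorem doubleMul_assoc (u v w : HopfDual k H ⊗[k] H) :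
    doubleMul k H (doubleMul k H u v) w = doubleMul k H u (doubleMul k H v w) := by
  induction u with
  | zero => simp
  | add u v hu hv => simp only [map_add, LinearMap.add_apply, hu, hv]
  | tmul f h =>
  induction v with
  | zero => simp
  | add u v hu hv => simp only [map_add, LinearMap.add_apply, hu, hv]
  | tmul g l =>
  induction w with
  | zero => simp
  | add u v hu hv => simp only [map_add, hu, hv]
  | tmul p q =>
  rw [doubleMul_tmul, doubleMul_tmul]
  generalize hv : straighten k H l p = v
  have h1 : ∀ w : HopfDual k H ⊗[k] H,
      doubleMul k H (TensorProduct.map (LinearMap.mulLeft k f) (LinearMap.mulRight k l) w)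
        (p ⊗ₜ q) = TensorProduct.map (LinearMap.mulLeft k f) (LinearMap.mulRight k q)
          (mulLeftFactor k H H (LinearMap.lTensor _ (((doubleMul k H).flip v) ∘ₗ
            TensorProduct.mk k _ _ 1) w)) := by
    intro w
    induction w with
    | zero => simp
    | add u v hu hv => simp only [map_add, LinearMap.add_apply, hu, hv]
    | tmul g' h' =>
      simp only [TensorProduct.map_tmul, LinearMap.mulLeft_apply, LinearMap.mulRight_apply,
        doubleMul_tmul, straighten_mul_left, hv, LinearMap.lTensor_tmul, LinearMap.comp_apply,
        TensorProduct.mk_apply, LinearMap.flip_apply]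
      induction doubleMul k H (1 ⊗ₜ h') v with
      | zero => simp
      | add u v hu hv => simp only [map_add, TensorProduct.tmul_add, hu, hv]
      | tmul a b => simp
  rw [h1]
  clear h1 hv
  induction v with
  | zero => 
    simp only [map_zero]
    simp
  | add u v hu hv =>
    simp only [map_add, LinearMap.add_apply, ← hu, ← hv, LinearMap.add_comp, LinearMap.lTensor_add]
  | tmul p' k' =>
    simp only [TensorProduct.map_tmul, doubleMul_tmul, LinearMap.mulLeft_apply,
      LinearMap.mulRight_apply, straighten_mul_right]
    induction straighten k H h g with
    | zero => simp
    | add u v hu hv => simp only [map_add, hu, hv]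
    | tmul g' h' =>
      simp only [LinearMap.lTensor_tmul, LinearMap.comp_apply,
        TensorProduct.mk_apply, LinearMap.flip_apply, doubleMul_tmul]
      induction straighten k H h' p' with
      | zero => simp
      | add u v hu hv => simp only [map_add, TensorProduct.tmul_add, hu, hv]
      | tmul a b => simp [mul_assoc]



theorem one_doubleMul (u : HopfDual k H ⊗[k] H) : doubleMul k H (1 ⊗ₜ 1) u = u := by
  induction u with
  | zero => simp
  | add u v hu hv => simp only [map_add, hu, hv]
  | tmul g l => simp [doubleMul_tmul, straighten_one_left]

theorem doubleMul_one (u : HopfDual k H ⊗[k] H) : doubleMul k H u (1 ⊗ₜ 1) = u := by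
  induction u with
  | zero => simp
  | add u v hu hv => simp only [map_add, LinearMap.add_apply, hu, hv]
  | tmul g l => simp [doubleMul_tmul, straighten_one_right]

/-- The Drinfeld double `D(H)` of a finite-dimensional Hopf algebra, with underlying vector space
`H* ⊗ H`. -/
def _root_.DrinfeldDouble : Type _ := HopfDual k H ⊗[k] H

instance : AddCommGroup (DrinfeldDouble k H) := inferInstanceAs (AddCommGroup (HopfDual k H ⊗[k] H))
instance : Module k (DrinfeldDouble k H) := inferInstanceAs (Module k (HopfDual k H ⊗[k] H))

/-- The product is `(f ⊗ h)(g ⊗ l) = ∑ f (h₍₁₎ ⇀ g ↼ S⁻¹(h₍₃₎)) ⊗ h₍₂₎ l`, the unit is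
`1 ⊗ 1 = ε ⊗ 1`. -/
instance : Ring (DrinfeldDouble k H) :=
  { (inferInstance : AddCommGroup (DrinfeldDouble k H)) with
    mul := fun u v => doubleMul k H u v
    one := (1 : HopfDual k H) ⊗ₜ[k] (1 : H)
    left_distrib := fun u v w => map_add (doubleMul k H u) v w
    right_distrib := fun u v w => LinearMap.map_add₂ (doubleMul k H) u v w
    zero_mul := fun u => LinearMap.map_zero₂ (doubleMul k H) u
    mul_zero := fun u => map_zero (doubleMul k H u)
    mul_assoc := doubleMul_assoc k H
    one_mul := one_doubleMul k H
    mul_one := doubleMul_one k H }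

instance : Algebra k (DrinfeldDouble k H) :=
  Algebra.ofModule (fun r u v => LinearMap.map_smul₂ (doubleMul k H) r u v)
    (fun r u v => map_smul (doubleMul k H u) r v)

/-- As a coalgebra, `D(H) = (H*)ᶜᵒᵖ ⊗ H`. -/
instance : Coalgebra k (DrinfeldDouble k H) :=
  inferInstanceAs (Coalgebra k (Cop (HopfDual k H) ⊗[k] H))

/-- The Drinfeld double is `H* ⊗ H` as a vector space. -/
def toDouble : HopfDual k H ⊗[k] H ≃ₗ[k] DrinfeldDouble k H := LinearEquiv.refl k _

variable {k H} in
/-- The element `f ⊗ h` of the Drinfeld double, also written `f h`. -/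
def _root_.DrinfeldDouble.of (f : HopfDual k H) (h : H) : DrinfeldDouble k H := f ⊗ₜ[k] h

open DrinfeldDouble

variable {k H}

theorem mul_def (u v : DrinfeldDouble k H) : u * v = doubleMul k H u v := rfl

theorem one_def : (1 : DrinfeldDouble k H) = of 1 1 := rfl

theorem of_mul_of (f g : HopfDual k H) (h l : H) :
    of f h * of g l = (TensorProduct.map (LinearMap.mulLeft k f) (LinearMap.mulRight k l)
        (straighten k H h g) : HopfDual k H ⊗[k] H) := doubleMul_tmul k H f g h l

theorem of_one_mul_of (f g : HopfDual k H) (l : H) : of f 1 * of g l = of (f * g) l := by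
  rw [of_mul_of, straighten_one_left]; simp; rfl

theorem of_mul_one_of (f : HopfDual k H) (h l : H) : of f h * of 1 l = of f (h * l) := by
  rw [of_mul_of, straighten_one_right]; simp; rfl

theorem one_of_mul_of_one (h : H) (g : HopfDual k H) :
    of 1 h * of g 1 = toDouble k H (straighten k H h g) := by
  rw [of_mul_of]; simp; rfl

variable (k H) in
/-- Rearrangement `(f ⊗ g) ⊗ (h ⊗ l) ↦ (f h) ⊗ (g l)`. -/
def pairUp : HopfDual k H ⊗[k] HopfDual k H →ₗ[k] H ⊗[k] H →ₗ[k]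
    DrinfeldDouble k H ⊗[k] DrinfeldDouble k H :=
  TensorProduct.curry (TensorProduct.tensorTensorTensorComm k _ _ _ _).toLinearMap

@[simp] theorem pairUp_tmul (f g : HopfDual k H) (h l : H) :
    pairUp k H (f ⊗ₜ g) (h ⊗ₜ l) = of f h ⊗ₜ of g l := rfl

theorem comul_of (f : HopfDual k H) (h : H) : comul (R := k) (of f h) =
    pairUp k H (TensorProduct.comm k _ _ (comulDual k H f)) (comul h) := rfl

theorem counit_of (f : HopfDual k H) (h : H) : counit (R := k) (of f h) =
    counit (R := k) h * f 1  := by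
  rfl

theorem dual_zero_mul (w : HopfDual k H ⊗[k] HopfDual k H) :
    (0 : HopfDual k H ⊗[k] HopfDual k H) * w = 0 := MulZeroClass.zero_mul w
theorem dual_mul_zero (w : HopfDual k H ⊗[k] HopfDual k H) :
    w * (0 : HopfDual k H ⊗[k] HopfDual k H) = 0 := MulZeroClass.mul_zero w
theorem dual_mul_add (w u v : HopfDual k H ⊗[k] HopfDual k H) :
    w * (u + v) = w * u + w * v := Distrib.left_distrib w u v
theorem dual_add_mul (u v w : HopfDual k H ⊗[k] HopfDual k H) :
    (u + v) * w = u * w + v * w := Distrib.right_distrib u v w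

theorem pairUp_mul_left (w w' : HopfDual k H ⊗[k] HopfDual k H) (v : H ⊗[k] H) :
    pairUp k H w 1 * pairUp k H w' v = pairUp k H (w * w') v := by
  induction w with
  | zero => simp [dual_zero_mul, dual_mul_zero]
  | add a b ha hb => simp only [map_add, LinearMap.add_apply, add_mul, dual_add_mul, ha, hb]
  | tmul f g =>
  induction w' with
  | zero => simp [dual_zero_mul, dual_mul_zero]
  | add a b ha hb => simp only [map_add, LinearMap.add_apply, mul_add, dual_mul_add, ha, hb]
  | tmul f' g' =>
  induction v with
  | zero => simp [dual_zero_mul, dual_mul_zero]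
  | add a b ha hb => simp only [map_add, mul_add, dual_mul_add, ha, hb]
  | tmul h l =>
    rw [Algebra.TensorProduct.one_def]
    simp only [pairUp_tmul, Algebra.TensorProduct.tmul_mul_tmul, of_one_mul_of]

theorem pairUp_mul_right (w : HopfDual k H ⊗[k] HopfDual k H) (v v' : H ⊗[k] H) :
    pairUp k H w v * pairUp k H 1 v' = pairUp k H w (v * v') := by
  induction w with
  | zero => simp [dual_zero_mul, dual_mul_zero]
  | add a b ha hb => simp only [map_add, LinearMap.add_apply, add_mul, dual_add_mul, ha, hb]
  | tmul f g =>
  induction v' with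
  | zero => simp [dual_zero_mul, dual_mul_zero]
  | add a b ha hb => simp only [map_add, mul_add, dual_mul_add, ha, hb]
  | tmul h' l' =>
  induction v with
  | zero => simp [dual_zero_mul, dual_mul_zero]
  | add a b ha hb => simp only [map_add, add_mul, dual_add_mul, ha, hb]
  | tmul h l =>
    rw [Algebra.TensorProduct.one_def]
    simp only [pairUp_tmul, Algebra.TensorProduct.tmul_mul_tmul, of_mul_one_of]

theorem comulDual_one : comulDual k H 1 = 1 := by
  refine evalDual_ext k fun x => ?_
  apply WithConv.ext
  ext y
  rw [evalDual_comulDual, Algebra.TensorProduct.one_def]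
  simp

theorem comulDual_mul (f g : HopfDual k H) :
    comulDual k H (f * g) = comulDual k H f * comulDual k H g := by
  refine evalDual_ext k fun x => ?_
  apply WithConv.ext
  ext y
  rw [evalDual_comulDual]
  have key : ∀ (w w' : HopfDual k H ⊗[k] HopfDual k H), (evalDual k x (w * w')) y =
      ∑ i ∈ (ℛ k x).index, ∑ j ∈ (ℛ k y).index,
        (evalDual k ((ℛ k x).left i) w) ((ℛ k y).left j) *
        (evalDual k ((ℛ k x).right i) w') ((ℛ k y).right j) := by
    intro w w'
    induction w with
    | zero => simp [dual_zero_mul, dual_mul_zero]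
    | add a b ha hb =>
      simp only [map_add, ofConv_add, LinearMap.add_apply, add_mul, dual_add_mul, ha, hb, Finset.sum_add_distrib]
    | tmul f g =>
    induction w' with
    | zero => simp [dual_zero_mul, dual_mul_zero]
    | add a b ha hb =>
      simp only [map_add, ofConv_add, LinearMap.add_apply, mul_add, dual_mul_add, ha, hb, Finset.sum_add_distrib]
    | tmul f' g' =>
      simp only [Algebra.TensorProduct.tmul_mul_tmul, evalDual_tmul, ofConv_smul,
        LinearMap.smul_apply, smul_eq_mul]
      rw [(ℛ k x).convMul_apply, (ℛ k y).convMul_apply, Finset.sum_mul_sum]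
      exact Finset.sum_congr rfl fun i _ => Finset.sum_congr rfl fun j _ => by ring
  rw [key]
  simp only [evalDual_comulDual]
  rw [LinearMap.convMul_apply, Bialgebra.comul_mul]
  conv_lhs => rw [← (ℛ k x).eq, ← (ℛ k y).eq]
  simp [Finset.sum_mul_sum]

theorem comul_map_mul (f : HopfDual k H) (l : H) (z : HopfDual k H ⊗[k] H) :
    comul (R := k) (A := DrinfeldDouble k H)
      (TensorProduct.map (LinearMap.mulLeft k f) (LinearMap.mulRight k l) z) =
    pairUp k H (TensorProduct.comm k _ _ (comulDual k H f)) 1 *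
      comul (R := k) (A := DrinfeldDouble k H) z * pairUp k H 1 (comul l) := by
  induction z with
  | zero => 
    rw [map_zero]
    erw [map_zero]
    simp
  | add a b ha hb => 
    rw [map_add]
    erw [map_add, map_add]
    rw [ha, hb, mul_add, add_mul]
  | tmul g h =>
    have hc : ∀ w w' : HopfDual k H ⊗[k] HopfDual k H, TensorProduct.comm k _ _ (w * w') =
        TensorProduct.comm k _ _ w * TensorProduct.comm k _ _ w' :=
      map_mul (Algebra.TensorProduct.comm k (HopfDual k H) (HopfDual k H))
    have h1 := comul_of (k := k) g h
    have h2 := comul_of (k := k) (f * g) (h * l)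
    rw [comulDual_mul, Bialgebra.comul_mul, hc] at h2
    rw [TensorProduct.map_tmul]
    refine h2.trans ?_
    rw [← pairUp_mul_left, ← pairUp_mul_right, mul_assoc]
    rfl

end Double

section Hopf
variable (k H : Type*) [Field k] [Ring H] [HopfAlgebra k H] [FiniteDimensional k H]
open DrinfeldDouble

/-- `(f ⊗ h) ⊗ (g ⊗ l) ↦ f(x) g(y) h ⊗ l`. -/
def eval₂ (x y : H) : DrinfeldDouble k H ⊗[k] DrinfeldDouble k H →ₗ[k] H ⊗[k] H :=
  TensorProduct.map (evalDual k x ∘ₗ (toDouble k H).symm.toLinearMap)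
    (evalDual k y ∘ₗ (toDouble k H).symm.toLinearMap)

theorem eval₂_ext {v w : DrinfeldDouble k H ⊗[k] DrinfeldDouble k H}
    (h : ∀ x y, eval₂ k H x y v = eval₂ k H x y w) : v = w := by
  let e : DrinfeldDouble k H ⊗[k] DrinfeldDouble k H ≃ₗ[k]
      HopfDual k H ⊗[k] (HopfDual k H ⊗[k] (H ⊗[k] H)) :=
    (TensorProduct.congr (toDouble k H).symm (toDouble k H).symm).trans
      ((TensorProduct.tensorTensorTensorComm k _ _ _ _).trans (TensorProduct.assoc k _ _ _))
  have he : ∀ x y u, evalDual k y (evalDual k x (e u)) = eval₂ k H x y u := by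
    intro x y u
    induction u with
    | zero => simp
    | add a b ha hb => simp only [map_add, ha, hb]
    | tmul a b =>
      obtain ⟨a, rfl⟩ := (toDouble k H).surjective a
      obtain ⟨b, rfl⟩ := (toDouble k H).surjective b
      induction a with
      | zero => simp
      | add a b ha hb => simp only [map_add, TensorProduct.add_tmul, ha, hb]
      | tmul f h =>
      induction b with
      | zero => simp
      | add a b ha hb => simp only [map_add, TensorProduct.tmul_add, ha, hb]
      | tmul g l =>
      simp [e, eval₂, TensorProduct.smul_tmul]
      exact smul_comm _ _ _
  apply e.injective
  refine evalDual_ext k fun x => evalDual_ext k fun y => ?_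
  rw [he, he, h]

/-- `a ⊗ d ⊗ c ↦ ⟨g, S⁻¹(c) y d x a⟩`. -/
def qFun (g : HopfDual k H) (x y : H) : H ⊗[k] (H ⊗[k] H) →ₗ[k] k :=
  g.ofConv ∘ₗ LinearMap.mul' k H ∘ₗ (TensorProduct.comm k H H).toLinearMap ∘ₗ
    TensorProduct.map (LinearMap.mulLeft k x) (LinearMap.mul' k H ∘ₗ
      (TensorProduct.comm k H H).toLinearMap ∘ₗ
      LinearMap.lTensor H (LinearMap.mulRight k y ∘ₗ antipodeInv k))

theorem qFun_tmul (g : HopfDual k H) (x y a d c : H) : qFun k H g x y (a ⊗ₜ (d ⊗ₜ c)) =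
    g (antipodeInv k c * y * d * (x * a)) := by
  simp [qFun]

/-- `a ⊗ b ⊗ d ⊗ b' ⊗ c ↦ ⟨g, S⁻¹(c) y d x a⟩ b ⊗ b'`. -/
def bigFun (g : HopfDual k H) (x y : H) :
    H ⊗[k] (H ⊗[k] (H ⊗[k] (H ⊗[k] H))) →ₗ[k] H ⊗[k] H :=
  (TensorProduct.rid k _).toLinearMap ∘ₗ LinearMap.lTensor (H ⊗[k] H) (qFun k H g x y) ∘ₗ
    (TensorProduct.leftComm k H (H ⊗[k] H) (H ⊗[k] H)).toLinearMap ∘ₗ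
    LinearMap.lTensor H ((TensorProduct.assoc k H H (H ⊗[k] H)).symm.toLinearMap ∘ₗ
      LinearMap.lTensor H (TensorProduct.leftComm k H H H).toLinearMap)

theorem bigFun_tmul (g : HopfDual k H) (x y a b d b' c : H) :
    bigFun k H g x y (a ⊗ₜ (b ⊗ₜ (d ⊗ₜ (b' ⊗ₜ c)))) =
      g (antipodeInv k c * y * d * (x * a)) • (b ⊗ₜ b') := by
  simp [bigFun, qFun_tmul]

/-- `c ⊗ a ↦ a S⁻¹(c)`. -/
def zetaFun : H ⊗[k] H →ₗ[k] H :=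
  LinearMap.mul' k H ∘ₗ TensorProduct.map LinearMap.id (antipodeInv k) ∘ₗ
    (TensorProduct.comm k H H).toLinearMap

theorem zetaFun_comp_comul : zetaFun k H ∘ₗ comul = Algebra.linearMap k H ∘ₗ counit := by
  ext h
  exact mul_comm_antipodeInv_left k h

theorem eval₂_comul_cross (g : HopfDual k H) (x y : H) :
    eval₂ k H x y ∘ₗ comul (A := DrinfeldDouble k H) ∘ₗ (toDouble k H).toLinearMap ∘ₗ cross k H H g =
    bigFun k H g x y ∘ₗ LinearMap.lTensor H (LinearMap.lTensor H (TensorProduct.mk k _ _ 1) ∘ₗ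
      (TensorProduct.assoc k H H H).toLinearMap ∘ₗ LinearMap.rTensor H comul) := by
  ext1; ext1 a; ext1; ext1 b; ext1 c
  have h1 : ∀ (p : HopfDual k H) (v : H ⊗[k] H),
      eval₂ k H x y (pairUp k H (TensorProduct.comm k _ _ (comulDual k H p)) v) =
        p (y * x) • v := by
    intro p v
    rw [← evalDual_comulDual]
    induction v with
    | zero => simp
    | add a b ha hb => simp only [map_add, ha, hb, smul_add]
    | tmul b b' =>
    induction comulDual k H p with
    | zero => simp
    | add a b ha hb => simp only [map_add, LinearMap.add_apply, ha, hb, ofConv_add, add_smul]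
    | tmul f g =>
      have e1 : ∀ (f : HopfDual k H) (h : H), (toDouble k H).symm (of f h) = f ⊗ₜ h :=
        fun _ _ => rfl
      simp [eval₂, e1, TensorProduct.smul_tmul, smul_smul, TensorProduct.tmul_smul, mul_comm]
  have h2 : comul (R := k) (toDouble k H (hit k a c g ⊗ₜ b)) = _ := comul_of (hit k a c g) b
  simp only [TensorProduct.AlgebraTensorModule.curry_apply, LinearMap.restrictScalars_self,
    TensorProduct.curry_apply, LinearMap.comp_apply, cross_tmul, LinearEquiv.coe_coe,
    LinearMap.lTensor_tmul, LinearMap.rTensor_tmul]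
  rw [h2, h1]
  induction comul (R := k) b with
  | zero => simp
  | add a b ha hb => simp only [map_add, ha, hb, smul_add, TensorProduct.add_tmul, TensorProduct.tmul_add]
  | tmul b b' => 
    simp [bigFun_tmul, mul_assoc]

/-- Regrouping of `(a ⊗ b ⊗ c) ⊗ (a' ⊗ b' ⊗ c')` as `a ⊗ b ⊗ a' S⁻¹(c) ⊗ b' ⊗ c'`. -/
def regroup : (H ⊗[k] (H ⊗[k] H)) ⊗[k] (H ⊗[k] (H ⊗[k] H)) →ₗ[k]
    H ⊗[k] (H ⊗[k] ((H ⊗[k] H) ⊗[k] (H ⊗[k] H))) :=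
  LinearMap.lTensor H (LinearMap.lTensor H
      (TensorProduct.assoc k H H (H ⊗[k] H)).symm.toLinearMap ∘ₗ
    (TensorProduct.assoc k H H _).toLinearMap) ∘ₗ (TensorProduct.assoc k H _ _).toLinearMap

theorem eval₂_straighten_aux (g : HopfDual k H) (x y : H)
    (s t : H ⊗[k] (H ⊗[k] H)) (w : HopfDual k H ⊗[k] HopfDual k H)
    (hw : ∀ a b, evalDual k a w b = g (b * a)) :
    TensorProduct.map (evalDual k x ∘ₗ (cross k H H).flip s)
      (evalDual k y ∘ₗ (cross k H H).flip t) w =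
    bigFun k H g x y (LinearMap.lTensor H (LinearMap.lTensor H
      (LinearMap.rTensor _ (zetaFun k H))) (regroup k H (s ⊗ₜ t))) := by
  induction s with
  | zero => simp
  | add a b ha hb =>
    simp only [map_add, LinearMap.comp_add, TensorProduct.map_add_left, LinearMap.add_apply,
      TensorProduct.add_tmul, ha, hb]
  | tmul a s =>
  induction s with
  | zero => simp
  | add a b ha hb =>
    simp only [map_add, LinearMap.comp_add, TensorProduct.map_add_left, LinearMap.add_apply,
      TensorProduct.add_tmul, TensorProduct.tmul_add, ha, hb]
  | tmul b c =>
  induction t with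
  | zero => simp
  | add a b ha hb =>
    simp only [map_add, LinearMap.comp_add, TensorProduct.map_add_right, LinearMap.add_apply,
      TensorProduct.tmul_add, ha, hb]
  | tmul a' t =>
  induction t with
  | zero => simp
  | add a b ha hb =>
    simp only [map_add, LinearMap.comp_add, TensorProduct.map_add_right, LinearMap.add_apply,
      TensorProduct.tmul_add, ha, hb]
  | tmul b' c' =>
  have h1 : ∀ w : HopfDual k H ⊗[k] HopfDual k H,
      TensorProduct.map (evalDual k x ∘ₗ (cross k H H).flip (a ⊗ₜ (b ⊗ₜ c)))
        (evalDual k y ∘ₗ (cross k H H).flip (a' ⊗ₜ (b' ⊗ₜ c'))) w =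
      (evalDual k (antipodeInv k c * x * a) w (antipodeInv k c' * y * a')) • (b ⊗ₜ b') := by
    intro w
    induction w with
    | zero => simp
    | add a b ha hb => simp only [map_add, ha, hb, ofConv_add, LinearMap.add_apply, add_smul]
    | tmul p q => simp [TensorProduct.smul_tmul, smul_smul, TensorProduct.tmul_smul, mul_comm]
  rw [h1, hw]
  simp [regroup, bigFun_tmul, zetaFun, mul_assoc]

theorem eval₂_pairUp_mul (g : HopfDual k H) (x y : H) (v : H ⊗[k] H)
    (w : HopfDual k H ⊗[k] HopfDual k H) (hw : ∀ a b, evalDual k a w b = g (b * a)) :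
    eval₂ k H x y (pairUp k H 1 v * pairUp k H w 1) =
    bigFun k H g x y (LinearMap.lTensor H (LinearMap.lTensor H
      (LinearMap.rTensor _ (zetaFun k H))) (regroup k H
        (TensorProduct.map (comul₃ k H) (comul₃ k H) v))) := by
  induction v with
  | zero => simp
  | add a b ha hb => simp only [map_add, add_mul, ha, hb]
  | tmul h l =>
  rw [TensorProduct.map_tmul, ← eval₂_straighten_aux k H g x y _ _ w hw]
  clear hw
  induction w with
  | zero => simp
  | add a b ha hb => simp only [map_add, LinearMap.add_apply, mul_add, ha, hb]
  | tmul p q =>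
    rw [Algebra.TensorProduct.one_def, Algebra.TensorProduct.one_def]
    simp only [pairUp_tmul, Algebra.TensorProduct.tmul_mul_tmul, one_of_mul_of_one]
    simp [eval₂, straighten_apply]

theorem regroup_comul₃ : LinearMap.lTensor H (LinearMap.lTensor H
      (LinearMap.rTensor _ (zetaFun k H))) ∘ₗ regroup k H ∘ₗ
        TensorProduct.map (comul₃ k H) (comul₃ k H) ∘ₗ comul =
    LinearMap.lTensor H (LinearMap.lTensor H (TensorProduct.mk k _ _ 1) ∘ₗ
      (TensorProduct.assoc k H H H).toLinearMap ∘ₗ LinearMap.rTensor H comul) ∘ₗ comul₃ k H := by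
  have h1 : regroup k H ∘ₗ TensorProduct.map (comul₃ k H) (comul₃ k H) ∘ₗ comul =
      LinearMap.lTensor H (LinearMap.lTensor H (LinearMap.rTensor _ comul)) ∘ₗ
        LinearMap.lTensor H (LinearMap.lTensor H (LinearMap.lTensor H comul ∘ₗ comul)) ∘ₗ
          comul₃ k H := by
    unfold comul₃ regroup
    simp only [coassoc_simps]
  have h2 : LinearMap.rTensor (H ⊗[k] H) (zetaFun k H ∘ₗ comul) ∘ₗ
      LinearMap.lTensor H comul ∘ₗ comul = TensorProduct.mk k H (H ⊗[k] H) 1 ∘ₗ comul := by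
    rw [zetaFun_comp_comul]
    ext1 h
    have := rTensor_counit_comul (R := k) h
    rw [← LinearMap.comp_assoc, LinearMap.rTensor_comp_lTensor, ← LinearMap.lTensor_comp_rTensor,
      LinearMap.rTensor_comp]
    simp only [LinearMap.comp_apply]
    rw [this]
    simp
  rw [h1]
  have h3 : ∀ (f : H ⊗[k] (H ⊗[k] H) →ₗ[k] H ⊗[k] (H ⊗[k] H)), f = f := fun _ => rfl
  calc _ = LinearMap.lTensor H (LinearMap.lTensor H (LinearMap.rTensor (H ⊗[k] H)
        (zetaFun k H ∘ₗ comul) ∘ₗ LinearMap.lTensor H comul ∘ₗ comul)) ∘ₗ comul₃ k H := by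
        simp only [LinearMap.rTensor_comp, LinearMap.lTensor_comp, LinearMap.comp_assoc]
    _ = LinearMap.lTensor H (LinearMap.lTensor H (TensorProduct.mk k H (H ⊗[k] H) 1)) ∘ₗ
        LinearMap.lTensor H (LinearMap.lTensor H comul) ∘ₗ comul₃ k H := by
        rw [h2]; simp only [LinearMap.lTensor_comp, LinearMap.comp_assoc]
    _ = _ := by
        rw [LinearMap.lTensor_comp H (LinearMap.lTensor H (TensorProduct.mk k H (H ⊗[k] H) 1)),
          LinearMap.comp_assoc]
        congr 1
        unfold comul₃
        simp only [coassoc_simps]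

theorem comul_straighten (h : H) (g : HopfDual k H) :
    comul (R := k) (toDouble k H (straighten k H h g)) =
      pairUp k H 1 (comul h) * pairUp k H (TensorProduct.comm k _ _ (comulDual k H g)) 1 := by
  refine eval₂_ext k H fun x y => ?_
  rw [eval₂_pairUp_mul k H g x y]
  · have h1 := LinearMap.congr_fun (eval₂_comul_cross k H g x y) (comul₃ k H h)
    have h2 := LinearMap.congr_fun (regroup_comul₃ k H) h
    simp only [LinearMap.comp_apply] at h1 h2
    rw [h2]
    exact h1
  · intro a b
    rw [← evalDual_comulDual]
    induction comulDual k H g with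
    | zero => simp
    | add a b ha hb => simp only [map_add, LinearMap.add_apply, ha, hb, ofConv_add]
    | tmul p q => simp [mul_comm]

theorem double_comul_mul (u v : DrinfeldDouble k H) :
    comul (R := k) (u * v) = comul u * comul v := by
  obtain ⟨u, rfl⟩ := (toDouble k H).surjective u
  obtain ⟨v, rfl⟩ := (toDouble k H).surjective v
  induction u with
  | zero => simp
  | add a b ha hb => simp only [map_add, add_mul, ha, hb]
  | tmul f h =>
  induction v with
  | zero => simp
  | add a b ha hb => simp only [map_add, mul_add, ha, hb]
  | tmul g l =>
  have h1 := comul_map_mul f l (straighten k H h g)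
  have h2 := comul_straighten k H h g
  change comul (R := k) (of f h * of g l) = comul (of f h) * comul (of g l)
  rw [of_mul_of]
  refine h1.trans ?_
  have h3 : ∀ w v, pairUp k H w v = pairUp k H w 1 * pairUp k H 1 v := fun w v => by
    rw [pairUp_mul_right, one_mul]
  rw [comul_of, comul_of, h3 (TensorProduct.comm k _ _ (comulDual k H f)) (comul h),
    h3 (TensorProduct.comm k _ _ (comulDual k H g)) (comul l)]
  have h4 : comul (R := k) (A := DrinfeldDouble k H) (straighten k H h g) = _ := h2
  rw [h4]
  simp only [mul_assoc]

theorem double_counit_mul (u v : DrinfeldDouble k H) :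
    counit (R := k) (u * v) = counit (R := k) u * counit (R := k) v := by
  obtain ⟨u, rfl⟩ := (toDouble k H).surjective u
  obtain ⟨v, rfl⟩ := (toDouble k H).surjective v
  induction u with
  | zero => simp
  | add a b ha hb => simp only [map_add, add_mul, ha, hb]
  | tmul f h =>
  induction v with
  | zero => simp
  | add a b ha hb => simp only [map_add, mul_add, ha, hb]
  | tmul g l =>
  have h1 : ∀ z : HopfDual k H ⊗[k] H, counit (R := k) (toDouble k H
      (TensorProduct.map (LinearMap.mulLeft k f) (LinearMap.mulRight k l) z)) =
      f 1 * counit (R := k) l * counit (R := k) (toDouble k H z) := by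
    intro z
    induction z with
    | zero => simp
    | add a b ha hb => simp only [map_add, mul_add, ha, hb]
    | tmul p q =>
      have e1 := counit_of (f * p) (q * l)
      have e2 := counit_of p q
      refine e1.trans ?_
      rw [show toDouble k H (p ⊗ₜ q) = of p q from rfl, e2]
      simp [Algebra.TensorProduct.one_def]
      ring
  have h2 : counit (R := k) (toDouble k H (straighten k H h g)) = g 1 * counit (R := k) h := by
    have e1 : counit (R := k) ∘ₗ (toDouble k H).toLinearMap ∘ₗ cross k H H g =
        g.ofConv ∘ₗ LinearMap.mul' k H ∘ₗ TensorProduct.map (antipodeInv k) LinearMap.id ∘ₗ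
          (TensorProduct.comm k H H).toLinearMap ∘ₗ
          LinearMap.lTensor H ((TensorProduct.lid k H).toLinearMap ∘ₗ
            LinearMap.rTensor H counit) := by
      ext1; ext1 a; ext1; ext1 b; intro c
      have e2 := counit_of (hit k a c g) b
      simp only [TensorProduct.AlgebraTensorModule.curry_apply, LinearMap.restrictScalars_self,
        TensorProduct.curry_apply, LinearMap.comp_apply, cross_tmul, LinearEquiv.coe_coe]
      refine e2.trans ?_
      simp
    have e2 := LinearMap.congr_fun e1 (comul₃ k H h)
    have e3 : LinearMap.lTensor H ((TensorProduct.lid k H).toLinearMap ∘ₗ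
        LinearMap.rTensor H counit) (comul₃ k H h) = comul h := by
      rw [comul₃, ← LinearMap.comp_apply, ← LinearMap.comp_assoc, ← LinearMap.lTensor_comp,
        LinearMap.comp_assoc, rTensor_counit_comp_comul]
      have : (TensorProduct.lid k H).toLinearMap ∘ₗ TensorProduct.mk k k H 1 = LinearMap.id := by
        ext; simp
      rw [this]
      simp
    simp only [LinearMap.comp_apply, LinearEquiv.coe_coe] at e2 e3
    refine e2.trans ?_
    have e4 := mul_comm_antipodeInv_right k h
    simp only [LinearMap.lTensor_comp, LinearMap.comp_apply] at e3 ⊢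
    rw [e3, e4, Algebra.algebraMap_eq_smul_one]
    simp [mul_comm]
  change counit (R := k) (of f h * of g l) = counit (R := k) (of f h) * counit (R := k) (of g l)
  rw [of_mul_of]
  refine (h1 _).trans ?_
  rw [h2, counit_of, counit_of]
  ring

instance : Bialgebra k (DrinfeldDouble k H) :=
  Bialgebra.mk' k (DrinfeldDouble k H)
    (by
      refine (counit_of (1 : HopfDual k H) (1 : H)).trans ?_
      simp)
    (double_counit_mul k H _ _)
    (by
      refine (comul_of (1 : HopfDual k H) (1 : H)).trans ?_
      rw [comulDual_one, Bialgebra.comul_one, Algebra.TensorProduct.one_def,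
        Algebra.TensorProduct.one_def]
      rfl)
    (double_comul_mul k H _ _)


/-- The antipode of `(H*)ᶜᵒᵖ`: `f ↦ f ∘ S⁻¹`. -/
def antipodeDual : HopfDual k H →ₗ[k] HopfDual k H :=
  (WithConv.linearEquiv k (H →ₗ[k] k)).symm.toLinearMap ∘ₗ (antipodeInv k).dualMap ∘ₗ
    (WithConv.linearEquiv k (H →ₗ[k] k)).toLinearMap

theorem antipodeDual_apply (f : HopfDual k H) (x : H) :
    antipodeDual k H f x = f (antipodeInv k x) := rfl

/-- The antipode of the Drinfeld double: `f ⊗ h ↦ S(h) (f ∘ S⁻¹)`. -/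
def doubleAntipode : DrinfeldDouble k H →ₗ[k] DrinfeldDouble k H :=
  (toDouble k H).toLinearMap ∘ₗ TensorProduct.lift
    ((straighten k H).flip.compl₁₂ (antipodeDual k H) (HopfAlgebra.antipode k)) ∘ₗ
      (toDouble k H).symm.toLinearMap

variable {k H} in
theorem doubleAntipode_of (f : HopfDual k H) (h : H) : doubleAntipode k H (of f h) =
    of 1 (HopfAlgebra.antipode k h) * of (antipodeDual k H f) 1 := by
  rw [one_of_mul_of_one]
  have e : (toDouble k H).symm (of f h) = f ⊗ₜ h := rfl
  simp [doubleAntipode, e]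

theorem antipodeDual_left (f : HopfDual k H) :
    LinearMap.mul' k (HopfDual k H) (LinearMap.rTensor _ (antipodeDual k H)
      (TensorProduct.comm k _ _ (comulDual k H f))) = f 1 • 1 := by
  have key : ∀ (w : HopfDual k H ⊗[k] HopfDual k H) (x : H),
      (LinearMap.mul' k (HopfDual k H) (LinearMap.rTensor _ (antipodeDual k H)
        (TensorProduct.comm k _ _ w))) x = ∑ i ∈ (ℛ k x).index,
        (evalDual k ((ℛ k x).right i) w) (antipodeInv k ((ℛ k x).left i)) := by
    intro w x
    induction w with
    | zero => simp
    | add a b ha hb => simp only [map_add, ofConv_add, LinearMap.add_apply, ha, hb,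
        Finset.sum_add_distrib]
    | tmul p q =>
      rw [TensorProduct.comm_tmul, LinearMap.rTensor_tmul, LinearMap.mul'_apply,
        (ℛ k x).convMul_apply]
      refine Finset.sum_congr rfl fun i _ => ?_
      rw [antipodeDual_apply]
      simp [mul_comm]
  apply WithConv.ext
  ext x
  rw [key]
  simp only [evalDual_comulDual]
  have e := mul_comm_antipodeInv_left k x
  rw [← (ℛ k x).eq] at e
  simp only [map_sum, TensorProduct.comm_tmul, TensorProduct.map_tmul, LinearMap.id_apply,
    LinearMap.mul'_apply] at e
  rw [← map_sum, e, Algebra.algebraMap_eq_smul_one]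
  simp [mul_comm]

theorem antipodeDual_right (f : HopfDual k H) :
    LinearMap.mul' k (HopfDual k H) (LinearMap.lTensor _ (antipodeDual k H)
      (TensorProduct.comm k _ _ (comulDual k H f))) = f 1 • 1 := by
  have key : ∀ (w : HopfDual k H ⊗[k] HopfDual k H) (x : H),
      (LinearMap.mul' k (HopfDual k H) (LinearMap.lTensor _ (antipodeDual k H)
        (TensorProduct.comm k _ _ w))) x = ∑ i ∈ (ℛ k x).index,
        (evalDual k (antipodeInv k ((ℛ k x).right i)) w) ((ℛ k x).left i) := by
    intro w x
    induction w with
    | zero => simp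
    | add a b ha hb => simp only [map_add, ofConv_add, LinearMap.add_apply, ha, hb,
        Finset.sum_add_distrib]
    | tmul p q =>
      rw [TensorProduct.comm_tmul, LinearMap.lTensor_tmul, LinearMap.mul'_apply,
        (ℛ k x).convMul_apply]
      refine Finset.sum_congr rfl fun i _ => ?_
      rw [antipodeDual_apply]
      simp [mul_comm]
  apply WithConv.ext
  ext x
  rw [key]
  simp only [evalDual_comulDual]
  have e := mul_comm_antipodeInv_right k x
  rw [← (ℛ k x).eq] at e
  simp only [map_sum, TensorProduct.comm_tmul, TensorProduct.map_tmul, LinearMap.id_apply,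
    LinearMap.mul'_apply] at e
  rw [← map_sum, e, Algebra.algebraMap_eq_smul_one]
  simp [mul_comm]

variable {k H} in
theorem smul_of (r : k) (f : HopfDual k H) (h : H) : of (r • f) h = r • of f h := rfl

variable {k H} in
theorem of_smul (r : k) (f : HopfDual k H) (h : H) : of f (r • h) = r • of f h :=
  TensorProduct.tmul_smul r f h

variable {k H} in
theorem double_algebraMap (r : k) : algebraMap k (DrinfeldDouble k H) r = r • of 1 1 := rfl

/-- `h ↦ 1 ⊗ h`. -/
def inclRight : H →ₗ[k] DrinfeldDouble k H :=
  (toDouble k H).toLinearMap ∘ₗ TensorProduct.mk k (HopfDual k H) H 1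

/-- `f ↦ f ⊗ 1`. -/
def inclLeft : HopfDual k H →ₗ[k] DrinfeldDouble k H :=
  (toDouble k H).toLinearMap ∘ₗ (TensorProduct.mk k (HopfDual k H) H).flip 1

variable {k H} in
theorem inclRight_apply (h : H) : inclRight k H h = of 1 h := rfl

variable {k H} in
theorem inclLeft_apply (f : HopfDual k H) : inclLeft k H f = of f 1 := rfl

theorem double_antipode_left (f : HopfDual k H) (h : H) :
    LinearMap.mul' k (DrinfeldDouble k H) (LinearMap.rTensor _ (doubleAntipode k H)
      (comul (of f h))) = algebraMap k _ (counit (of f h)) := by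
  have h1 : ∀ (w : HopfDual k H ⊗[k] HopfDual k H) (a b : H),
      LinearMap.mul' k (DrinfeldDouble k H) (LinearMap.rTensor _ (doubleAntipode k H)
        (pairUp k H w (a ⊗ₜ b))) = inclRight k H (HopfAlgebra.antipode k a) * inclLeft k H
          (LinearMap.mul' k (HopfDual k H) (LinearMap.rTensor _ (antipodeDual k H) w)) *
          inclRight k H b := by
    intro w a b
    induction w with
    | zero => simp
    | add u v hu hv => simp only [map_add, LinearMap.add_apply, mul_add, add_mul, hu, hv]
    | tmul p q =>
      simp only [pairUp_tmul, LinearMap.rTensor_tmul, LinearMap.mul'_apply, doubleAntipode_of,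
        inclRight_apply, inclLeft_apply]
      rw [show of q b = of q 1 * of 1 b by rw [of_mul_one_of, one_mul],
        show of (antipodeDual k H p * q) (1 : H) = of (antipodeDual k H p) 1 * of q 1 by
          rw [of_one_mul_of]]
      simp only [mul_assoc]
  have h2 : ∀ v : H ⊗[k] H,
      LinearMap.mul' k (DrinfeldDouble k H) (LinearMap.rTensor _ (doubleAntipode k H)
        (pairUp k H (TensorProduct.comm k _ _ (comulDual k H f)) v)) =
      f 1 • inclRight k H (LinearMap.mul' k H (LinearMap.rTensor H (HopfAlgebra.antipode k) v)) := by
    intro v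
    induction v with
    | zero => simp
    | add u v hu hv => simp only [map_add, smul_add, hu, hv]
    | tmul a b =>
      rw [h1, antipodeDual_left]
      simp only [map_smul, inclLeft_apply, inclRight_apply, LinearMap.rTensor_tmul,
        LinearMap.mul'_apply, mul_smul_comm, smul_mul_assoc, of_mul_one_of, mul_one]
  rw [comul_of, h2, HopfAlgebra.mul_antipode_rTensor_comul_apply, counit_of, double_algebraMap,
    Algebra.algebraMap_eq_smul_one, map_smul, inclRight_apply, smul_smul, mul_comm]

theorem double_antipode_right (f : HopfDual k H) (h : H) :
    LinearMap.mul' k (DrinfeldDouble k H) (LinearMap.lTensor _ (doubleAntipode k H)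
      (comul (of f h))) = algebraMap k _ (counit (of f h)) := by
  have h1 : ∀ (p q : HopfDual k H) (v : H ⊗[k] H),
      LinearMap.mul' k (DrinfeldDouble k H) (LinearMap.lTensor _ (doubleAntipode k H)
        (pairUp k H (p ⊗ₜ q) v)) = inclLeft k H p * inclRight k H
          (LinearMap.mul' k H (LinearMap.lTensor _ (HopfAlgebra.antipode k) v)) *
          inclLeft k H (antipodeDual k H q) := by
    intro p q v
    induction v with
    | zero => simp
    | add u v hu hv => simp only [map_add, mul_add, add_mul, hu, hv]
    | tmul a b =>
      simp only [pairUp_tmul, LinearMap.lTensor_tmul, LinearMap.mul'_apply, doubleAntipode_of,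
        inclRight_apply, inclLeft_apply]
      rw [show of p a = of p 1 * of 1 a by rw [of_mul_one_of, one_mul],
        show of (1 : HopfDual k H) (a * HopfAlgebra.antipode k b) =
          of 1 a * of 1 (HopfAlgebra.antipode k b) by rw [of_mul_one_of]]
      simp only [mul_assoc]
  have h2 : ∀ w : HopfDual k H ⊗[k] HopfDual k H,
      LinearMap.mul' k (DrinfeldDouble k H) (LinearMap.lTensor _ (doubleAntipode k H)
        (pairUp k H w (comul h))) =
      counit (R := k) h • inclLeft k H (LinearMap.mul' k (HopfDual k H)
        (LinearMap.lTensor _ (antipodeDual k H) w)) := by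
    intro w
    induction w with
    | zero => simp
    | add u v hu hv => simp only [map_add, LinearMap.add_apply, smul_add, hu, hv]
    | tmul p q =>
      rw [h1, HopfAlgebra.mul_antipode_lTensor_comul_apply, Algebra.algebraMap_eq_smul_one]
      simp only [map_smul, inclLeft_apply, inclRight_apply, LinearMap.lTensor_tmul,
        LinearMap.mul'_apply, mul_smul_comm, smul_mul_assoc, of_mul_one_of, mul_one,
        of_one_mul_of]
  rw [comul_of, h2, antipodeDual_right, counit_of, double_algebraMap, map_smul, inclLeft_apply,
    smul_smul]

instance : HopfAlgebra k (DrinfeldDouble k H) where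
  antipode := doubleAntipode k H
  mul_antipode_rTensor_comul := by
    apply (LinearMap.cancel_right (toDouble k H).surjective).1
    exact TensorProduct.ext' fun f h => double_antipode_left k H f h
  mul_antipode_lTensor_comul := by
    apply (LinearMap.cancel_right (toDouble k H).surjective).1
    exact TensorProduct.ext' fun f h => double_antipode_right k H f h

end Hopf

section UniversalR
variable (k H : Type*) [Field k] [Ring H] [HopfAlgebra k H] [FiniteDimensional k H]
open DrinfeldDouble

/-- The standard universal `R`-matrix of the Drinfeld double,
`R = ∑ᵢ (1 ⊗ hᵢ) ⊗ (hⁱ ⊗ 1)`, where `hᵢ` is a basis of `H` and `hⁱ` is its dual basis.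
It does not depend on the basis, see `universalR_eq`. -/
def _root_.DrinfeldDouble.universalR : DrinfeldDouble k H ⊗[k] DrinfeldDouble k H :=
  ∑ i, of 1 (Module.finBasis k H i) ⊗ₜ[k] of (toConv ((Module.finBasis k H).coord i)) 1

variable {H} in
theorem evalDual_sum_basis {ι : Type*} [Fintype ι] (b : Module.Basis ι k H) (x : H) :
    evalDual k x (∑ i, toConv (b.coord i) ⊗ₜ[k] b i) = x := by
  simp only [map_sum, evalDual_tmul]
  exact b.sum_repr x

variable {k H} in
theorem universalR_eq {ι : Type*} [Fintype ι] (b : Module.Basis ι k H) :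
    universalR k H = ∑ i, of 1 (b i) ⊗ₜ[k] of (toConv (b.coord i)) 1 := by
  have h2 : ∑ i, toConv (b.coord i) ⊗ₜ[k] b i =
      ∑ i, toConv ((Module.finBasis k H).coord i) ⊗ₜ[k] Module.finBasis k H i :=
    evalDual_ext k fun x => by rw [evalDual_sum_basis, evalDual_sum_basis]
  have h3 := congrArg (fun u => TensorProduct.map (inclRight k H) (inclLeft k H)
    (TensorProduct.comm k _ _ u)) h2
  simp only [map_sum, TensorProduct.comm_tmul, TensorProduct.map_tmul] at h3
  exact h3.symm

end UniversalR

section Factorizable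
variable (k : Type*) {A : Type*} [Field k] [Ring A] [HopfAlgebra k A]

/-- `R₁₂ = ∑ R⁽¹⁾ ⊗ R⁽²⁾ ⊗ 1`. -/
def leg₁₂ : A ⊗[k] A →ₐ[k] A ⊗[k] (A ⊗[k] A) :=
  Algebra.TensorProduct.map (AlgHom.id k A) Algebra.TensorProduct.includeLeft

/-- `R₁₃ = ∑ R⁽¹⁾ ⊗ 1 ⊗ R⁽²⁾`. -/
def leg₁₃ : A ⊗[k] A →ₐ[k] A ⊗[k] (A ⊗[k] A) :=
  Algebra.TensorProduct.map (AlgHom.id k A) Algebra.TensorProduct.includeRight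

/-- `R₂₃ = ∑ 1 ⊗ R⁽¹⁾ ⊗ R⁽²⁾`. -/
def leg₂₃ : A ⊗[k] A →ₐ[k] A ⊗[k] (A ⊗[k] A) :=
  Algebra.TensorProduct.includeRight

/-- `(A, R)` is a quasitriangular Hopf algebra: `R` is invertible,
`(Δ ⊗ id)(R) = R₁₃ R₂₃`, `(id ⊗ Δ)(R) = R₁₃ R₁₂` and `Δᵒᵖ(h) R = R Δ(h)`. -/
structure IsQuasitriangular (R : A ⊗[k] A) : Prop where
  isUnit : IsUnit R
  comul_left : TensorProduct.assoc k A A A (LinearMap.rTensor A comul R) =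
    leg₁₃ k R * leg₂₃ k R
  comul_right : LinearMap.lTensor A comul R = leg₁₃ k R * leg₁₂ k R
  comul_op : ∀ h : A, TensorProduct.comm k A A (comul (R := k) h) * R = R * comul (R := k) h

/-- The map `f_Q : A* → A`, `f_Q(p) = (p ⊗ id)(Q)`. -/
def evalLeft (Q : A ⊗[k] A) : Module.Dual k A →ₗ[k] A :=
  (TensorProduct.lid k A).toLinearMap ∘ₗ (LinearMap.rTensorHom (R := k) A).flip Q

@[simp] theorem evalLeft_tmul (a b : A) (p : Module.Dual k A) :
    evalLeft k (a ⊗ₜ b) p = p a • b := by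
  simp [evalLeft]

/-- `(A, R)` is a factorizable Hopf algebra: it is quasitriangular, and the map
`p ↦ (p ⊗ id)(R₂₁ R)` from `A*` to `A` is a linear isomorphism. -/
structure IsFactorizable (R : A ⊗[k] A) : Prop extends IsQuasitriangular k R where
  bijective : Function.Bijective (evalLeft k (TensorProduct.comm k A A R * R))

/-- The group algebra `⟨g⟩` generated by an element `g` of finite order of `G(A)`, that is, the
linear span of the powers of `g`. -/
def groupAlgebra (g : A) : Subalgebra k A := Algebra.adjoin k {g}

/-- `⟨g⟩` is the linear span of the powers of `g`. -/
theorem toSubmodule_groupAlgebra (g : A) : Subalgebra.toSubmodule (groupAlgebra k g) =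
    Submodule.span k (Set.range fun i : ℕ => g ^ i) := by
  rw [groupAlgebra, Algebra.adjoin_eq_span, Submonoid.closure_singleton_eq]
  rfl

variable {k}

/-- A subalgebra `K` is a Hopf subalgebra if `Δ(K) ⊆ K ⊗ K` and `S(K) ⊆ K`. -/
structure IsHopfSubalgebra (K : Subalgebra k A) : Prop where
  comul_mem : ∀ y ∈ K, comul (R := k) y ∈
    LinearMap.range (TensorProduct.map K.val.toLinearMap K.val.toLinearMap)
  antipode_mem : ∀ y ∈ K, HopfAlgebra.antipode k y ∈ K

/-- The left adjoint action `y ↦ ∑ h₍₁₎ y S(h₍₂₎)`. -/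
def adjointLeft (h y : A) : A :=
  LinearMap.mul' k A (LinearMap.lTensor A (LinearMap.mulLeft k y ∘ₗ HopfAlgebra.antipode k)
    (comul (R := k) h))

/-- The right adjoint action `y ↦ ∑ S(h₍₁₎) y h₍₂₎`. -/
def adjointRight (h y : A) : A :=
  LinearMap.mul' k A (TensorProduct.map (HopfAlgebra.antipode k) (LinearMap.mulLeft k y)
    (comul (R := k) h))

/-- A Hopf subalgebra is normal if it is stable under both adjoint actions. -/
structure IsNormalHopfSubalgebra (K : Subalgebra k A) : Prop extends IsHopfSubalgebra K where
  adjointLeft_mem : ∀ h : A, ∀ y ∈ K, adjointLeft (k := k) h y ∈ K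
  adjointRight_mem : ∀ h : A, ∀ y ∈ K, adjointRight (k := k) h y ∈ K

/-- The left ideal `A K⁺`, where `K⁺ = K ∩ ker ε`. -/
def augmentationIdeal (K : Subalgebra k A) : Ideal A :=
  Ideal.span {y | y ∈ K ∧ counit (R := k) y = 0}

variable (k) in
/-- The image of `R` in `A/I ⊗ A/I`. -/
def quotientR (I : Ideal A) [I.IsTwoSided] (R : A ⊗[k] A) : (A ⧸ I) ⊗[k] (A ⧸ I) :=
  TensorProduct.map (Ideal.Quotient.mkₐ k I).toLinearMap (Ideal.Quotient.mkₐ k I).toLinearMap R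

end Factorizable

end
end HopfDouble

open HopfDouble

/-!
Write `g = χ x`, `D = D(H)`, `ω = χ(x)`, and `f_Q(p) = (p ⊗ id)(Q)` with `Q = R₂₁ R`.

The computations in `D` rest on one exchange relation, `∑ h₍₁₎ (f ↼ h₍₂₎) = ∑ (h₍₁₎ ⇀ f) h₍₂₎`
(`exchange`). Together with the properties of the canonical element `∑ hⁱ ⊗ hᵢ` of `H* ⊗ H`, it
gives the quasitriangularity of `D` (`universalR_isQuasitriangular`). For group-like `χ` and `x`
it shows that `g` is central as soon as `χ (x ⇀ f ↼ x⁻¹) = f χ` for all `f` in `H*`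
(`commute_of_of_forall`). On the dual basis this identity is what hypotheses (i) and (ii) say, once
one knows that `σ` and `τ` commute, and that follows from `(χ E) χ = χ (E χ)` (`convMul_conj_eq`).

Since `g` is central and group-like with `g ^ n = 1`, the algebra `⟨g⟩` is a normal Hopf subalgebra
and `I = D⟨g⟩⁺ = D (g - 1)` is a two-sided Hopf ideal; quasitriangularity passes to `D / I`.

For the bijectivity of `f_Q` on `D / I`, let `η` be the functional `f h ↦ f(x) χ(h)` on `D`.
Then `f_Q(η p) = g f_Q(p)` (`evalLeft_convLeft_doubleFunctional`) and `η(d g) = ω² η(d)`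
(`doubleFunctional_mul`). As `n` is odd, `ω²` is a primitive `n`-th root of unity, so `D*` is the
sum of the eigenspaces of translation by `g`, with eigenvalues `(ω²) ^ c`, and convolution with
`η ^ (n - c)` carries the eigenspace for `(ω²) ^ c` into the space `(D / I)*` of invariant
functionals. Modulo `I` this does not change `f_Q`, because `g` becomes `1`. Since `f_Q : D* → D` is
onto (`evalLeft_universalR_surjective`), so is its analogue `(D / I)* → D / I`
(`bijective_evalLeft_quotient`), and the two spaces have the same dimension.
-/

namespace HopfDouble
open TensorProduct Coalgebra DrinfeldDouble

/-! ### The exchange relation in the Drinfeld double -/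

section Exchange
variable (k : Type*) {H : Type*} [Field k] [Ring H] [HopfAlgebra k H]

/-- The left action of `H` on its dual, `⟨h ⇀ f, y⟩ = ⟨f, y h⟩`. -/
def leftHit (h : H) : HopfDual k H →ₗ[k] HopfDual k H :=
  (WithConv.linearEquiv k (H →ₗ[k] k)).symm.toLinearMap ∘ₗ (LinearMap.mulRight k h).dualMap ∘ₗ
    (WithConv.linearEquiv k (H →ₗ[k] k)).toLinearMap

/-- The right action of `H` on its dual, `⟨f ↼ h, y⟩ = ⟨f, h y⟩`. -/
def rightHit (h : H) : HopfDual k H →ₗ[k] HopfDual k H :=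
  (WithConv.linearEquiv k (H →ₗ[k] k)).symm.toLinearMap ∘ₗ (LinearMap.mulLeft k h).dualMap ∘ₗ
    (WithConv.linearEquiv k (H →ₗ[k] k)).toLinearMap

@[simp] theorem leftHit_apply (h : H) (f : HopfDual k H) (y : H) :
    leftHit k h f y = f (y * h) := rfl

@[simp] theorem rightHit_apply (h : H) (f : HopfDual k H) (y : H) :
    rightHit k h f y = f (h * y) := rfl

/-- The map `a ⊗ b ⊗ e ↦ ⟨f, e y a⟩ b`. -/
def exchangeEval (f : HopfDual k H) (y : H) : H ⊗[k] (H ⊗[k] H) →ₗ[k] H :=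
  (TensorProduct.rid k H).toLinearMap ∘ₗ LinearMap.lTensor H (f.ofConv ∘ₗ LinearMap.mul' k H ∘ₗ
    LinearMap.rTensor H (LinearMap.mulRight k y) ∘ₗ (TensorProduct.comm k H H).toLinearMap) ∘ₗ
      (TensorProduct.leftComm k H H H).toLinearMap

@[simp] theorem exchangeEval_tmul (f : HopfDual k H) (y a b e : H) :
    exchangeEval k f y (a ⊗ₜ (b ⊗ₜ e)) = f (e * y * a) • b := by
  simp [exchangeEval]

variable [FiniteDimensional k H]

/-- The terms `h₍₁₎ (f ↼ h₍₂₎)` of the exchange relation, evaluated at `y` in the leg `H*`: with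
`t = a ⊗ b ⊗ c` the value is `⟨f, d S⁻¹(c) y a⟩ b`. -/
theorem evalDual_cross_rightHit (f : HopfDual k H) (y d : H) (t : H ⊗[k] (H ⊗[k] H)) :
    evalDual k y (cross k H H (rightHit k d f) t) =
      exchangeEval k f y (LinearMap.lTensor H (LinearMap.lTensor H (zetaFun k H))
        (LinearMap.lTensor H (TensorProduct.assoc k H H H).toLinearMap
          (TensorProduct.assoc k H (H ⊗[k] H) H (t ⊗ₜ d)))) := by
  induction t with
  | zero => simp
  | add a b ha hb => simp only [map_add, ha, hb, TensorProduct.add_tmul]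
  | tmul a t =>
  induction t with
  | zero => simp
  | add a b ha hb => simp only [map_add, ha, hb, TensorProduct.add_tmul, TensorProduct.tmul_add]
  | tmul b c => simp [zetaFun, mul_assoc]

/-- The exchange relation `∑ h₍₁₎ (f ↼ h₍₂₎) = ∑ (h₍₁₎ ⇀ f) h₍₂₎` in the Drinfeld double: moving
`h₍₁₎` past `f ↼ h₍₂₎` produces the factor `h₍₄₎ S⁻¹(h₍₃₎)`, which collapses. -/
theorem exchange (h : H) {ι : Type*} (r : Coalgebra.Repr k h ι) (f : HopfDual k H) :
    ∑ i ∈ r.index, of 1 (r.left i) * of (rightHit k (r.right i) f) 1 =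
      ∑ i ∈ r.index, of (leftHit k (r.left i) f) (r.right i) := by
  simp only [one_of_mul_of_one, ← map_sum]
  change toDouble k H _ = toDouble k H (∑ i ∈ r.index, leftHit k (r.left i) f ⊗ₜ[k] r.right i)
  congr 1
  refine evalDual_ext k fun y => ?_
  -- Coassociativity groups `h₍₃₎` and `h₍₄₎`, and `h₍₄₎ S⁻¹(h₍₃₎)` is then the counit.
  have h1 : LinearMap.lTensor H (TensorProduct.assoc k H H H).toLinearMap ∘ₗ
      (TensorProduct.assoc k H (H ⊗[k] H) H).toLinearMap ∘ₗ
      LinearMap.rTensor H (comul₃ k H) ∘ₗ comul =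
      LinearMap.lTensor H (LinearMap.lTensor H comul) ∘ₗ comul₃ k H := by
    unfold comul₃
    simp only [coassoc_simps]
  have h2 : LinearMap.lTensor H (LinearMap.lTensor H (zetaFun k H)) ∘ₗ
      LinearMap.lTensor H (LinearMap.lTensor H comul) ∘ₗ comul₃ k H =
      LinearMap.lTensor H (LinearMap.lTensor H (Algebra.linearMap k H)) ∘ₗ
        LinearMap.lTensor H ((TensorProduct.mk k H k).flip 1) ∘ₗ comul := by
    rw [← lTensor_counit_comp_comul, LinearMap.lTensor_comp, comul₃]
    simp only [← LinearMap.comp_assoc, ← LinearMap.lTensor_comp, zetaFun_comp_comul]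
  have h12 := LinearMap.congr_fun h2 h
  have h1' := LinearMap.congr_fun h1 h
  simp only [LinearMap.comp_apply, LinearEquiv.coe_coe] at h1' h12
  rw [← h1', ← r.eq] at h12
  have h3 := congrArg (exchangeEval k f y) h12
  simp only [map_sum, LinearMap.rTensor_tmul, LinearMap.lTensor_tmul, LinearMap.flip_apply,
    TensorProduct.mk_apply, ← evalDual_cross_rightHit, exchangeEval_tmul] at h3
  simpa [straighten_apply] using h3

end Exchange

/-! ### The Drinfeld double is quasitriangular -/

section Quasitriangular
variable (k : Type*) {H : Type*} [Field k] [Ring H] [HopfAlgebra k H]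
variable {ι : Type*} [Fintype ι] (b : Module.Basis ι k H)

variable {k} in
theorem sum_coord_smul (y : H) : ∑ i, (toConv (b.coord i) : HopfDual k H) y • b i = y :=
  b.sum_repr y

theorem sum_apply_smul_coord (f : HopfDual k H) : ∑ i, f (b i) • toConv (b.coord i) = f := by
  ext y
  simp only [ofConv_sum, ofConv_smul, LinearMap.sum_apply, LinearMap.smul_apply]
  conv_rhs => rw [← sum_coord_smul b y, map_sum]
  exact Finset.sum_congr rfl fun i _ => by rw [map_smul]; exact mul_comm _ _

variable {k} in
/-- `∑ᵢⱼ ⟨hⁱ hʲ, y⟩ hᵢ ⊗ hⱼ = Δ(y)`: the product of `H*` is dual to the comultiplication of `H`. -/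
theorem sum_convMul_coord_smul (y : H) : ∑ i, ∑ j,
    (toConv (b.coord i) * toConv (b.coord j) : HopfDual k H) y • b i ⊗ₜ[k] b j =
      comul (R := k) y := by
  have key : ∀ w : H ⊗[k] H, ∑ i, ∑ j, LinearMap.mul' k k
      (TensorProduct.map (b.coord i) (b.coord j) w) • b i ⊗ₜ[k] b j = w := by
    intro w
    induction w with
    | zero => simp
    | add u v hu hv => simp only [map_add, add_smul, Finset.sum_add_distrib, hu, hv]
    | tmul u v =>
      conv_rhs => rw [← sum_coord_smul b u, ← sum_coord_smul b v, TensorProduct.sum_tmul]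
      simp only [TensorProduct.tmul_sum, TensorProduct.smul_tmul_smul]
      rfl
  exact key _

variable {k} in
theorem sum_mul_coord_smul (f : HopfDual k H) (y : H) {κ : Type*} (r : Coalgebra.Repr k y κ) :
    ∑ i, (f * toConv (b.coord i)) y • b i = ∑ s ∈ r.index, f (r.left s) • r.right s := by
  simp only [r.convMul_apply, Finset.sum_smul]
  rw [Finset.sum_comm]
  simp only [mul_smul, ← Finset.smul_sum]
  exact Finset.sum_congr rfl fun s _ => by rw [sum_coord_smul b]

variable {k} in
theorem sum_coord_mul_smul (f : HopfDual k H) (y : H) {κ : Type*} (r : Coalgebra.Repr k y κ) :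
    ∑ i, (toConv (b.coord i) * f) y • b i = ∑ s ∈ r.index, f (r.right s) • r.left s := by
  simp only [r.convMul_apply, Finset.sum_smul]
  rw [Finset.sum_comm]
  simp only [mul_comm _ (f.ofConv _), mul_smul, ← Finset.smul_sum]
  exact Finset.sum_congr rfl fun s _ => by rw [sum_coord_smul b]

variable [FiniteDimensional k H]

theorem comul_of_one (h : H) : comul (R := k) (of (1 : HopfDual k H) h) =
    TensorProduct.map (inclRight k H) (inclRight k H) (comul (R := k) h) := by
  rw [comul_of, comulDual_one, Algebra.TensorProduct.one_def, TensorProduct.comm_tmul]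
  induction comul (R := k) h with
  | zero => simp
  | add a b ha hb => simp only [map_add, ha, hb]
  | tmul a b => rfl

theorem comul_of_dual (f : HopfDual k H) : comul (R := k) (of f (1 : H)) =
    TensorProduct.map (inclLeft k H) (inclLeft k H)
      (TensorProduct.comm k _ _ (comulDual k H f)) := by
  rw [comul_of, Bialgebra.comul_one, Algebra.TensorProduct.one_def]
  induction comulDual k H f with
  | zero => simp
  | add a b ha hb => simp only [map_add, LinearMap.add_apply, ha, hb]
  | tmul a b => rfl

variable {k} in
/-- The canonical element `∑ hⁱ ⊗ hᵢ` corresponds to the identity of `H`; acting by `h` on one leg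
amounts to multiplying by `h` on the other. -/
theorem sum_rightHit_coord (h : H) : ∑ i, rightHit k h (toConv (b.coord i)) ⊗ₜ[k] b i =
    ∑ i, toConv (b.coord i) ⊗ₜ[k] (h * b i) := by
  refine evalDual_ext k fun y => ?_
  simp only [map_sum, evalDual_tmul, rightHit_apply, ← mul_smul_comm, ← Finset.mul_sum,
    sum_coord_smul]

variable {k} in
theorem sum_leftHit_coord (h : H) : ∑ i, leftHit k h (toConv (b.coord i)) ⊗ₜ[k] b i =
    ∑ i, toConv (b.coord i) ⊗ₜ[k] (b i * h) := by
  refine evalDual_ext k fun y => ?_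
  simp only [map_sum, evalDual_tmul, leftHit_apply, ← smul_mul_assoc, ← Finset.sum_mul,
    sum_coord_smul]

/-- The inverse of `R` is `(S ⊗ id)(R)`: as `H* ⊗ H` with the product `f g ⊗ h l` is the convolution
algebra of endomorphisms of `H`, this is the statement that `S` is inverse to the identity. -/
theorem universalR_isUnit : IsUnit (universalR k H) := by
  let b := Module.finBasis k H
  let R' : DrinfeldDouble k H ⊗[k] DrinfeldDouble k H :=
    ∑ i, of 1 (HopfAlgebra.antipode k (b i)) ⊗ₜ[k] of (toConv (b.coord i)) 1
  let F : HopfDual k H ⊗[k] H →ₗ[k] DrinfeldDouble k H ⊗[k] DrinfeldDouble k H :=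
    TensorProduct.map (inclRight k H) (inclLeft k H) ∘ₗ (TensorProduct.comm k _ _).toLinearMap
  have hF : ∀ f h, F (f ⊗ₜ h) = of 1 h ⊗ₜ of f 1 := fun _ _ => rfl
  have e1 : ∀ u v : H → H, (∀ y, ∑ i, ∑ j,
      (toConv (b.coord i) * toConv (b.coord j) : HopfDual k H) y • (u (b i) * v (b j)) =
        algebraMap k H (counit y)) →
      (∑ i, of 1 (u (b i)) ⊗ₜ[k] of (toConv (b.coord i)) 1) *
      (∑ i, of 1 (v (b i)) ⊗ₜ[k] of (toConv (b.coord i)) 1) =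
        (1 : DrinfeldDouble k H ⊗[k] DrinfeldDouble k H) := by
    intro u v h
    have h1 : ∑ i, ∑ j, (toConv (b.coord i) * toConv (b.coord j) : HopfDual k H) ⊗ₜ[k]
        (u (b i) * v (b j)) = 1 ⊗ₜ 1 := by
      refine evalDual_ext k fun y => ?_
      simp only [map_sum, evalDual_tmul]
      rw [h, LinearMap.convOne_apply, Algebra.algebraMap_eq_smul_one]
      simp
    have h2 := congrArg F h1
    simp only [map_sum, hF] at h2
    rw [Algebra.TensorProduct.one_def, one_def, ← h2, Finset.sum_mul_sum]
    simp only [Algebra.TensorProduct.tmul_mul_tmul, of_one_mul_of, of_mul_one_of]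
  have hm : ∀ (u v : H →ₗ[k] H) (y : H), ∑ i, ∑ j,
      (toConv (b.coord i) * toConv (b.coord j) : HopfDual k H) y • (u (b i) * v (b j)) =
        LinearMap.mul' k H (TensorProduct.map u v (comul (R := k) y)) := by
    intro u v y
    rw [← sum_convMul_coord_smul b y]
    simp
  refine ⟨⟨_, R', ?_, ?_⟩, rfl⟩
  · exact e1 id (HopfAlgebra.antipode k) fun y => (hm LinearMap.id _ y).trans
      (HopfAlgebra.mul_antipode_lTensor_comul_apply y)
  · exact e1 (HopfAlgebra.antipode k) id fun y => (hm _ LinearMap.id y).trans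
      (HopfAlgebra.mul_antipode_rTensor_comul_apply y)

theorem universalR_comul_left :
    TensorProduct.assoc k _ _ _ (LinearMap.rTensor _ comul (universalR k H)) =
      leg₁₃ k (universalR k H) * leg₂₃ k (universalR k H) := by
  let b := Module.finBasis k H
  let F : HopfDual k H ⊗[k] (H ⊗[k] H) →ₗ[k]
      DrinfeldDouble k H ⊗[k] (DrinfeldDouble k H ⊗[k] DrinfeldDouble k H) :=
    (TensorProduct.assoc k _ _ _).toLinearMap ∘ₗ (TensorProduct.comm k _ _).toLinearMap ∘ₗ
      TensorProduct.map (inclLeft k H) (TensorProduct.map (inclRight k H) (inclRight k H))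
  have hF : ∀ f h l, F (f ⊗ₜ (h ⊗ₜ l)) = of 1 h ⊗ₜ (of 1 l ⊗ₜ of f 1) := fun _ _ _ => rfl
  have hF' : ∀ f h, F (f ⊗ₜ (comul h)) =
      TensorProduct.assoc k _ _ _ (comul (of 1 h) ⊗ₜ of f 1) := by
    intro f h
    rw [comul_of_one]
    rfl
  have h1 : ∑ i, toConv (b.coord i) ⊗ₜ[k] comul (R := k) (b i) =
      ∑ i, ∑ j, (toConv (b.coord i) * toConv (b.coord j) : HopfDual k H) ⊗ₜ[k]
        (b i ⊗ₜ[k] b j) := by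
    refine evalDual_ext k fun y => ?_
    simp only [map_sum, evalDual_tmul]
    rw [sum_convMul_coord_smul]
    conv_rhs => rw [← sum_coord_smul b y]
    simp only [map_sum, map_smul]
  have h2 := congrArg F h1
  simp only [map_sum, hF, hF'] at h2
  rw [universalR_eq b]
  simp only [map_sum, LinearMap.rTensor_tmul]
  rw [h2, Finset.sum_mul_sum]
  refine Finset.sum_congr rfl fun i _ => Finset.sum_congr rfl fun j _ => ?_
  simp [leg₁₃, leg₂₃, of_one_mul_of]

theorem universalR_comul_right :
    LinearMap.lTensor _ comul (universalR k H) =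
      leg₁₃ k (universalR k H) * leg₁₂ k (universalR k H) := by
  let b := Module.finBasis k H
  let F : HopfDual k H ⊗[k] (HopfDual k H ⊗[k] H) →ₗ[k]
      DrinfeldDouble k H ⊗[k] (DrinfeldDouble k H ⊗[k] DrinfeldDouble k H) :=
    TensorProduct.map (inclRight k H) (TensorProduct.map (inclLeft k H) (inclLeft k H)) ∘ₗ
      LinearMap.lTensor H (TensorProduct.comm k _ _).toLinearMap ∘ₗ
        (TensorProduct.comm k _ _).toLinearMap ∘ₗ (TensorProduct.assoc k _ _ _).symm.toLinearMap
  have hF : ∀ f g h, F (f ⊗ₜ (g ⊗ₜ h)) = of 1 h ⊗ₜ (of g 1 ⊗ₜ of f 1) := fun _ _ _ => rfl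
  have hF' : ∀ f h, F (TensorProduct.assoc k _ _ _ (comulDual k H f ⊗ₜ h)) =
      of 1 h ⊗ₜ comul (of f (1 : H)) := by
    intro f h
    rw [comul_of_dual]
    simp only [F, LinearMap.comp_apply, LinearEquiv.coe_coe, LinearEquiv.symm_apply_apply]
    rfl
  have h1 : TensorProduct.assoc k _ _ _ (LinearMap.rTensor H (comulDual k H)
      (∑ i, toConv (b.coord i) ⊗ₜ[k] b i)) =
      ∑ i, ∑ j, toConv (b.coord i) ⊗ₜ[k] (toConv (b.coord j) ⊗ₜ[k] (b i * b j)) := by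
    refine evalDual_ext k fun y => evalDual_ext k fun z => ?_
    rw [evalDual_assoc_rTensor_comulDual, evalDual_sum_basis]
    simp only [map_sum, evalDual_tmul, map_smul]
    conv_lhs => rw [← sum_coord_smul b y, ← sum_coord_smul b z, Finset.sum_mul_sum]
    simp only [smul_mul_smul_comm, smul_smul]
  have h2 := congrArg F h1
  simp only [map_sum, hF, hF', LinearMap.rTensor_tmul] at h2
  rw [universalR_eq b]
  simp only [map_sum, LinearMap.lTensor_tmul]
  rw [h2, Finset.sum_mul_sum]
  refine Finset.sum_congr rfl fun i _ => Finset.sum_congr rfl fun j _ => ?_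
  simp [leg₁₃, leg₁₂, of_mul_one_of]

/-- `Δᵒᵖ(h) R = R Δ(h)` for `h` in `H`. In `∑ h₍₂₎ hᵢ ⊗ h₍₁₎ hⁱ` the factor `h₍₂₎` moves to the
second leg as `hⁱ ↼ h₍₂₎`, the exchange relation applies there, and `h₍₁₎ ⇀ hⁱ` moves back. -/
theorem universalR_comul_op_right (h : H) :
    TensorProduct.comm k _ _ (comul (R := k) (of (1 : HopfDual k H) h)) * universalR k H =
      universalR k H * comul (R := k) (of 1 h) := by
  let b := Module.finBasis k H
  let r := ℛ k h
  let F : H → HopfDual k H ⊗[k] H →ₗ[k] DrinfeldDouble k H ⊗[k] DrinfeldDouble k H :=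
    fun c => TensorProduct.map (inclRight k H) (LinearMap.mulLeft k (of 1 c) ∘ₗ inclLeft k H) ∘ₗ
      (TensorProduct.comm k _ _).toLinearMap
  have hF : ∀ c f h, F c (f ⊗ₜ h) = of 1 h ⊗ₜ (of 1 c * of f 1) := fun _ _ _ => rfl
  let G : H → HopfDual k H ⊗[k] H →ₗ[k] DrinfeldDouble k H ⊗[k] DrinfeldDouble k H :=
    fun c => TensorProduct.map (inclRight k H) (LinearMap.mulRight k (of 1 c) ∘ₗ inclLeft k H) ∘ₗ
      (TensorProduct.comm k _ _).toLinearMap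
  have hG : ∀ c f h, G c (f ⊗ₜ h) = of 1 h ⊗ₜ (of f 1 * of 1 c) := fun _ _ _ => rfl
  have h1 : ∀ c d, ∑ i, of (1 : HopfDual k H) (d * b i) ⊗ₜ[k] (of 1 c * of (toConv (b.coord i)) 1) =
      ∑ i, of 1 (b i) ⊗ₜ[k] (of 1 c * of (rightHit k d (toConv (b.coord i))) 1) := by
    intro c d
    have := congrArg (F c) (sum_rightHit_coord b d)
    simpa only [map_sum, hF] using this.symm
  have h2 : ∀ c d, ∑ i, of (1 : HopfDual k H) (b i * d) ⊗ₜ[k] (of (toConv (b.coord i)) 1 * of 1 c) =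
      ∑ i, of 1 (b i) ⊗ₜ[k] (of (leftHit k d (toConv (b.coord i))) 1 * of 1 c) := by
    intro c d
    have := congrArg (G c) (sum_leftHit_coord b d)
    simpa only [map_sum, hG] using this.symm
  rw [comul_of_one, universalR_eq b, ← r.eq]
  simp only [map_sum, TensorProduct.map_tmul, TensorProduct.comm_tmul, inclRight_apply,
    Finset.sum_mul_sum, Algebra.TensorProduct.tmul_mul_tmul, of_mul_one_of (1 : HopfDual k H)]
  rw [Finset.sum_comm (s := Finset.univ)]
  simp only [h1, h2]
  rw [Finset.sum_comm, Finset.sum_comm (s := r.index)]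
  refine Finset.sum_congr rfl fun i _ => ?_
  rw [← TensorProduct.tmul_sum, ← TensorProduct.tmul_sum, exchange k h r]
  simp only [of_mul_one_of, one_mul]

/-- `Δᵒᵖ(f) R = R Δ(f)` for `f` in `H*`: evaluated at `z` in the second leg, this is the exchange
relation for `z` and `f`. -/
theorem universalR_comul_op_left (f : HopfDual k H) :
    TensorProduct.comm k _ _ (comul (R := k) (of f (1 : H))) * universalR k H =
      universalR k H * comul (R := k) (of f 1) := by
  let b := Module.finBasis k H
  let r := ℛ k f
  have hr : comulDual k H f = ∑ s ∈ r.index, r.left s ⊗ₜ[k] r.right s := r.eq.symm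
  have hf : ∀ y z, ∑ s ∈ r.index, r.left s y * r.right s z = f (y * z) := by
    intro y z
    rw [← evalDual_comulDual, hr]
    simp
  let F : HopfDual k H ⊗[k] DrinfeldDouble k H →ₗ[k] DrinfeldDouble k H ⊗[k] DrinfeldDouble k H :=
    LinearMap.lTensor _ (inclLeft k H) ∘ₗ (TensorProduct.comm k _ _).toLinearMap
  have hF : ∀ f d, F (f ⊗ₜ d) = d ⊗ₜ of f 1 := fun _ _ => rfl
  have h0 : ∑ s ∈ r.index, ∑ i, (r.right s * toConv (b.coord i)) ⊗ₜ[k] of (r.left s) (b i) =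
      ∑ i, ∑ s ∈ r.index, (toConv (b.coord i) * r.left s) ⊗ₜ[k]
        (of 1 (b i) * of (r.right s) 1) := by
    refine evalDual_ext k fun z => ?_
    have ez := exchange k z (ℛ k z) f
    have e1 : ∀ c, leftHit k c f = ∑ s ∈ r.index, r.right s c • r.left s := by
      intro c
      ext y
      simp [← hf, mul_comm]
    have e2 : ∀ c, rightHit k c f = ∑ s ∈ r.index, r.left s c • r.right s := by
      intro c
      ext y
      simp [← hf]
    have e3 : ∀ s, ∑ i, (r.right s * toConv (b.coord i)) z • of (r.left s) (b i) =
        ∑ t ∈ (ℛ k z).index, r.right s ((ℛ k z).left t) • of (r.left s) ((ℛ k z).right t) := by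
      intro s
      have := congrArg ((toDouble k H).toLinearMap ∘ₗ TensorProduct.mk k _ _ (r.left s))
        (sum_mul_coord_smul b (r.right s) z (ℛ k z))
      simp only [map_sum, map_smul] at this
      exact this
    have e4 : ∀ s, ∑ i, (toConv (b.coord i) * r.left s) z • (of 1 (b i) * of (r.right s) 1) =
        ∑ t ∈ (ℛ k z).index, r.left s ((ℛ k z).right t) •
          (of 1 ((ℛ k z).left t) * of (r.right s) 1) := by
      intro s
      have := congrArg (LinearMap.mulRight k (of (r.right s) 1) ∘ₗ inclRight k H)
        (sum_coord_mul_smul b (r.left s) z (ℛ k z))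
      simp only [map_sum, map_smul] at this
      exact this
    simp only [map_sum, evalDual_tmul]
    rw [Finset.sum_comm (s := Finset.univ)]
    simp only [e3, e4]
    rw [Finset.sum_comm, Finset.sum_comm (s := r.index)]
    simp only [e1, e2, ← inclLeft_apply, map_sum, map_smul] at ez
    simp only [inclLeft_apply, Finset.mul_sum, mul_smul_comm] at ez
    rw [ez]
    refine Finset.sum_congr rfl fun t _ => ?_
    have e5 : ∀ c, of (∑ s ∈ r.index, r.right s c • r.left s) ((ℛ k z).right t) =
        ∑ s ∈ r.index, r.right s c • of (r.left s) ((ℛ k z).right t) := by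
      intro c
      have := map_sum
        ((toDouble k H).toLinearMap ∘ₗ (TensorProduct.mk k _ _).flip ((ℛ k z).right t))
        (fun s => r.right s c • r.left s) r.index
      simp only [map_smul] at this
      exact this
    exact (e5 _).symm
  have h1 := congrArg F h0
  simp only [map_sum, hF] at h1
  rw [comul_of_dual, universalR_eq b, hr]
  simp only [map_sum, TensorProduct.map_tmul, TensorProduct.comm_tmul, inclLeft_apply,
    Finset.sum_mul_sum, Algebra.TensorProduct.tmul_mul_tmul, of_one_mul_of, mul_one, h1]

/-- The Drinfeld double with its standard `R`-matrix is quasitriangular. -/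
theorem universalR_isQuasitriangular : IsQuasitriangular k (universalR k H) where
  isUnit := universalR_isUnit k
  comul_left := universalR_comul_left k
  comul_right := universalR_comul_right k
  comul_op := by
    intro d
    obtain ⟨d, rfl⟩ := (toDouble k H).surjective d
    induction d with
    | zero => simp
    | add u v hu hv => simp only [map_add, add_mul, mul_add, hu, hv]
    | tmul f h =>
      have hc : ∀ u v : DrinfeldDouble k H ⊗[k] DrinfeldDouble k H,
          TensorProduct.comm k _ _ (u * v) =
            TensorProduct.comm k _ _ u * TensorProduct.comm k _ _ v :=
        map_mul (Algebra.TensorProduct.comm k (DrinfeldDouble k H) (DrinfeldDouble k H))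
      rw [show toDouble k H (f ⊗ₜ h) = of f 1 * of 1 h by rw [of_mul_one_of, one_mul]; rfl,
        Bialgebra.comul_mul, hc, mul_assoc, universalR_comul_op_right, ← mul_assoc,
        universalR_comul_op_left, mul_assoc]

end Quasitriangular

/-! ### Quotients of quasitriangular Hopf algebras -/

section Quotient
variable {k A B : Type*} [Field k] [Ring A] [HopfAlgebra k A] [Ring B] [HopfAlgebra k B]

theorem comm_map_apply (f : A →ₐ[k] B) (u : A ⊗[k] A) :
    TensorProduct.comm k B B (Algebra.TensorProduct.map f f u) =
      Algebra.TensorProduct.map f f (TensorProduct.comm k A A u) := by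
  induction u with
  | zero => simp
  | add u v hu hv => simp only [map_add, hu, hv]
  | tmul a b => simp

/-- The image of a quasitriangular structure under a surjective bialgebra homomorphism is a
quasitriangular structure. -/
theorem IsQuasitriangular.map {R : A ⊗[k] A} (hR : IsQuasitriangular k R) (f : A →ₐ[k] B)
    (hf : Function.Surjective f)
    (hc : ∀ a, comul (R := k) (f a) = Algebra.TensorProduct.map f f (comul (R := k) a)) :
    IsQuasitriangular k (Algebra.TensorProduct.map f f R) where
  isUnit := hR.isUnit.map _
  comul_left := by
    let F := Algebra.TensorProduct.map f (Algebra.TensorProduct.map f f)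
    have h1 : ∀ u : A ⊗[k] A, TensorProduct.assoc k B B B (LinearMap.rTensor B comul
        (Algebra.TensorProduct.map f f u)) =
        F (TensorProduct.assoc k A A A (LinearMap.rTensor A comul u)) := by
      intro u
      induction u with
      | zero => simp
      | add u v hu hv => simp only [map_add, hu, hv]
      | tmul a b =>
        simp only [Algebra.TensorProduct.map_tmul, LinearMap.rTensor_tmul, hc]
        induction comul (R := k) a with
        | zero => simp
        | add u v hu hv => simp only [map_add, TensorProduct.add_tmul, hu, hv]
        | tmul c d => simp [F]
    have h2 : ∀ u : A ⊗[k] A, leg₁₃ k (Algebra.TensorProduct.map f f u) = F (leg₁₃ k u) := by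
      intro u
      induction u with
      | zero => simp
      | add u v hu hv => simp only [map_add, hu, hv]
      | tmul a b => simp [F, leg₁₃]
    have h3 : ∀ u : A ⊗[k] A, leg₂₃ k (Algebra.TensorProduct.map f f u) = F (leg₂₃ k u) := by
      intro u
      simp [F, leg₂₃]
    rw [h1, hR.comul_left, map_mul, h2, h3]
  comul_right := by
    let F := Algebra.TensorProduct.map f (Algebra.TensorProduct.map f f)
    have h1 : ∀ u : A ⊗[k] A, LinearMap.lTensor B comul (Algebra.TensorProduct.map f f u) =
        F (LinearMap.lTensor A comul u) := by
      intro u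
      induction u with
      | zero => simp
      | add u v hu hv => simp only [map_add, hu, hv]
      | tmul a b => simp [F, hc]
    have h2 : ∀ u : A ⊗[k] A, leg₁₃ k (Algebra.TensorProduct.map f f u) = F (leg₁₃ k u) := by
      intro u
      induction u with
      | zero => simp
      | add u v hu hv => simp only [map_add, hu, hv]
      | tmul a b => simp [F, leg₁₃]
    have h3 : ∀ u : A ⊗[k] A, leg₁₂ k (Algebra.TensorProduct.map f f u) = F (leg₁₂ k u) := by
      intro u
      induction u with
      | zero => simp
      | add u v hu hv => simp only [map_add, hu, hv]
      | tmul a b => simp [F, leg₁₂]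
    rw [h1, hR.comul_right, map_mul, h2, h3]
  comul_op := by
    intro b
    obtain ⟨a, rfl⟩ := hf b
    rw [hc, comm_map_apply, ← map_mul, hR.comul_op, map_mul]

end Quotient

/-! ### Factorizability of the quotient by a central group-like element -/

section Eigen
variable {k V : Type*} [Field k] [CharZero k] [AddCommGroup V] [Module k V]

/-- A linear operator `T` with `T ^ n = 1` is diagonalizable when the base field contains a
primitive `n`-th root of unity `ζ`: the components are `n⁻¹ ∑ᵢ ζ⁻ᶜⁱ Tⁱ p`. -/
theorem exists_sum_eigenvectors {n : ℕ} (hn : n ≠ 0) {ζ : k} (hζ : IsPrimitiveRoot ζ n)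
    (T : Module.End k V) (hT : T ^ n = 1) (p : V) :
    ∃ q : ℕ → V, (∀ c, T (q c) = ζ ^ c • q c) ∧ ∑ c ∈ Finset.range n, q c = p := by
  have hn' : (n : k) ≠ 0 := Nat.cast_ne_zero.2 hn
  have hζ0 : ζ ≠ 0 := hζ.ne_zero hn
  refine ⟨fun c => (n : k)⁻¹ • ∑ i ∈ Finset.range n, (ζ⁻¹ ^ c) ^ i • (T ^ i) p, fun c => ?_, ?_⟩
  · have h1 : ∑ i ∈ Finset.range n, (ζ⁻¹ ^ c) ^ (i + 1) • (T ^ (i + 1)) p =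
        ∑ i ∈ Finset.range n, (ζ⁻¹ ^ c) ^ i • (T ^ i) p := by
      have h2 := (Finset.sum_range_succ (fun i => (ζ⁻¹ ^ c) ^ i • (T ^ i) p) n).symm.trans
        (Finset.sum_range_succ' _ n)
      have h3 : (ζ⁻¹ ^ c) ^ n = 1 := by
        rw [← pow_mul, mul_comm, pow_mul, inv_pow, hζ.pow_eq_one, inv_one, one_pow]
      rw [h3, hT, pow_zero, pow_zero] at h2
      exact (add_right_cancel h2).symm
    rw [map_smul, smul_comm]
    congr 1
    conv_rhs => rw [← h1]
    rw [Finset.smul_sum, map_sum]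
    refine Finset.sum_congr rfl fun i _ => ?_
    have h4 : ζ ^ c * (ζ⁻¹ ^ c) ^ (i + 1) = (ζ⁻¹ ^ c) ^ i := by
      rw [pow_succ', ← mul_assoc, ← mul_pow, mul_inv_cancel₀ hζ0, one_pow, one_mul]
    rw [map_smul, smul_smul, h4, pow_succ' T, Module.End.mul_apply]
  · rw [← Finset.smul_sum, Finset.sum_comm]
    simp only [← Finset.sum_smul]
    rw [Finset.sum_eq_single 0]
    · simp [smul_smul, hn']
    · intro i hi hi0
      have h1 : ζ⁻¹ ^ i ≠ 1 := by
        rw [inv_pow, inv_ne_one]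
        exact hζ.pow_ne_one_of_pos_of_lt hi0 (Finset.mem_range.1 hi)
      have h2 : ∑ c ∈ Finset.range n, (ζ⁻¹ ^ c) ^ i = 0 := by
        have h3 : ∀ c, (ζ⁻¹ ^ c) ^ i = (ζ⁻¹ ^ i) ^ c := fun c => by
          rw [← pow_mul, mul_comm, pow_mul]
        simp only [h3]
        rw [geom_sum_eq h1, ← pow_mul, mul_comm, pow_mul, inv_pow, hζ.pow_eq_one]
        simp
      rw [h2, zero_smul]
    · intro h
      exact absurd (Finset.mem_range.2 (Nat.pos_of_ne_zero hn)) h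

end Eigen

section Factorizable
variable {k A : Type*} [Field k] [Ring A] [HopfAlgebra k A]

/-- The operator `p ↦ η * p` of left convolution on the dual of `A`. -/
noncomputable def convLeft (η : Module.Dual k A) : Module.End k (Module.Dual k A) :=
  (WithConv.linearEquiv k (A →ₗ[k] k)).toLinearMap ∘ₗ
    LinearMap.mulLeft k (toConv η : WithConv (A →ₗ[k] k)) ∘ₗ
      (WithConv.linearEquiv k (A →ₗ[k] k)).symm.toLinearMap

theorem convLeft_apply (η p : Module.Dual k A) (a : A) : convLeft η p a =
    LinearMap.mul' k k (TensorProduct.map η p (comul (R := k) a)) := rfl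

/-- Let `g` be a group-like element of order dividing `n`, let `f_Q` be surjective, and let `η` be
a functional with `f_Q(η * p) = g f_Q(p)` on which translation by `g` acts by a primitive `n`-th
root of unity. Then `f_Q` induces an isomorphism for the quotient by `g - 1`: convolution by a
power of `η` moves every eigenvector of the translation by `g` to an invariant functional, and
changes its image under `f_Q` only by a power of `g`, which is trivial in the quotient. -/
theorem bijective_evalLeft_quotient [CharZero k] [FiniteDimensional k A] {n : ℕ} (hn : n ≠ 0)
    {g : A} (hg : IsGroupLikeElem k g) (hgn : g ^ n = 1) (I : Ideal A) [I.IsTwoSided]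
    [I.IsHopfIdeal k] (hI : I = Ideal.span {g - 1}) {Q : A ⊗[k] A}
    (hQ : Function.Surjective (evalLeft k Q))
    (η : Module.Dual k A) (hη : ∀ p, evalLeft k Q (convLeft η p) = g * evalLeft k Q p)
    {ζ : k} (hζ : IsPrimitiveRoot ζ n) (hηg : ∀ a, η (a * g) = ζ * η a) :
    Function.Bijective (evalLeft k (quotientR k I Q)) := by
  let π := Ideal.Quotient.mkₐ k I
  have hπ : Function.Surjective π := Ideal.Quotient.mk_surjective
  have hπg : π g = 1 := by
    rw [← sub_eq_zero, ← map_one π, ← map_sub]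
    exact Ideal.Quotient.eq_zero_iff_mem.2 (hI ▸ Ideal.subset_span rfl)
  have hev : ∀ (q : Module.Dual k (A ⧸ I)) (u : A ⊗[k] A),
      evalLeft k (quotientR k I u) q = π (evalLeft k u (q ∘ₗ π.toLinearMap)) := by
    intro q u
    induction u with
    | zero => simp [quotientR, evalLeft]
    | add u v hu hv =>
      simp only [quotientR, evalLeft, map_add, LinearMap.comp_apply, LinearMap.add_apply] at hu hv ⊢
      rw [hu, hv]
    | tmul a b => simp [quotientR, π]
  let T : Module.End k (Module.Dual k A) := (LinearMap.mulRight k g).dualMap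
  have hTa : ∀ p a, T p a = p (a * g) := fun _ _ => rfl
  have hTn : T ^ n = 1 := by
    have : ∀ (i : ℕ) p a, (T ^ i) p a = p (a * g ^ i) := by
      intro i
      induction i with
      | zero => simp
      | succ i ih =>
        intro p a
        rw [pow_succ, Module.End.mul_apply, ih, hTa, mul_assoc, pow_succ]
    ext p a
    simp [this, hgn]
  have hTη : ∀ p, T (convLeft η p) = ζ • convLeft η (T p) := by
    intro p
    ext a
    rw [hTa, LinearMap.smul_apply, convLeft_apply, convLeft_apply, Bialgebra.comul_mul,
      hg.comul_eq_tmul_self]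
    induction comul (R := k) a with
    | zero => simp
    | add u v hu hv => simp only [map_add, add_mul, smul_add, hu, hv]
    | tmul a b => simp [hTa, hηg, mul_assoc]
  have hTη' : ∀ (m : ℕ) p, T ((convLeft η ^ m) p) = ζ ^ m • (convLeft η ^ m) (T p) := by
    intro m
    induction m with
    | zero => simp
    | succ m ih =>
      intro p
      rw [pow_succ', Module.End.mul_apply, hTη, ih, map_smul, smul_smul, ← pow_succ']
      rfl
  have hη' : ∀ (m : ℕ) p, evalLeft k Q ((convLeft η ^ m) p) = g ^ m * evalLeft k Q p := by
    intro m
    induction m with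
    | zero => simp
    | succ m ih =>
      intro p
      rw [pow_succ', Module.End.mul_apply, hη, ih, ← mul_assoc, ← pow_succ']
  have hsurj : Function.Surjective (evalLeft k (quotientR k I Q)) := by
    intro y
    obtain ⟨a, rfl⟩ := hπ y
    obtain ⟨p, rfl⟩ := hQ a
    obtain ⟨q, hq, rfl⟩ := exists_sum_eigenvectors hn hζ T hTn p
    let w : Module.Dual k A := ∑ c ∈ Finset.range n, (convLeft η ^ (n - c)) (q c)
    have hw : T w = w := by
      simp only [w, map_sum]
      refine Finset.sum_congr rfl fun c hc => ?_
      rw [hTη', hq, map_smul, smul_smul, ← pow_add,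
        Nat.sub_add_cancel (Finset.mem_range.1 hc).le, hζ.pow_eq_one, one_smul]
    -- Invariant functionals vanish on `A (g - 1)`.
    have hwI : ∀ a ∈ I, w a = 0 := by
      intro a ha
      rw [hI] at ha
      obtain ⟨d, rfl⟩ := Ideal.mem_span_singleton'.1 ha
      rw [mul_sub, mul_one, map_sub, ← hTa, hw, sub_self]
    let w' : Module.Dual k (A ⧸ I) := Submodule.liftQ (I.restrictScalars k) w hwI
    have hw' : w' ∘ₗ π.toLinearMap = w := rfl
    refine ⟨w', ?_⟩
    rw [hev, hw']
    simp only [w, map_sum, hη', map_mul, map_pow, hπg, one_pow, one_mul]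
  have : FiniteDimensional k (A ⧸ I) := Module.Finite.of_surjective π.toLinearMap hπ
  exact ⟨(LinearMap.injective_iff_surjective_of_finrank_eq_finrank
    Subspace.dual_finrank_eq).2 hsurj, hsurj⟩

end Factorizable

/-! ### Hopf ideals generated by central group-like elements -/

section Central
variable {k A : Type*} [Field k] [Ring A] [HopfAlgebra k A]

theorem commute_of_mem_groupAlgebra {g : A} (hg : ∀ a, Commute g a) {y : A}
    (hy : y ∈ groupAlgebra k g) (a : A) : Commute y a := by
  have : groupAlgebra k g ≤ Subalgebra.centralizer k {a} := by
    refine Algebra.adjoin_le ?_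
    rintro _ rfl
    exact (Subalgebra.mem_centralizer_iff k).2 (by rintro _ rfl; exact (hg _).symm)
  exact ((Subalgebra.mem_centralizer_iff k).1 (this hy) a rfl).symm

theorem isNormalHopfSubalgebra_groupAlgebra {g : A} (hg : ∀ a, Commute g a)
    (hgl : IsGroupLikeElem k g) {n : ℕ} (hn : n ≠ 0) (hgn : g ^ n = 1) :
    IsNormalHopfSubalgebra (groupAlgebra k g) where
  comul_mem := by
    intro y hy
    rw [← Subalgebra.mem_toSubmodule, toSubmodule_groupAlgebra] at hy
    induction hy using Submodule.span_induction with
    | zero => simp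
    | add u v _ _ hu hv => rw [map_add]; exact add_mem hu hv
    | smul r u _ hu => rw [map_smul]; exact Submodule.smul_mem _ r hu
    | mem u hu =>
      obtain ⟨i, rfl⟩ := hu
      have hm : g ^ i ∈ groupAlgebra k g := pow_mem (Algebra.self_mem_adjoin_singleton k g) i
      refine ⟨⟨g ^ i, hm⟩ ⊗ₜ ⟨g ^ i, hm⟩, ?_⟩
      change (g ^ i) ⊗ₜ[k] (g ^ i) = comul (R := k) (g ^ i)
      exact (hgl.pow.comul_eq_tmul_self).symm
  antipode_mem := by
    have hS : HopfAlgebra.antipode k g = g ^ (n - 1) := by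
      refine left_inv_eq_right_inv hgl.antipode_mul_cancel ?_
      rw [← pow_succ', Nat.sub_add_cancel (Nat.one_le_iff_ne_zero.2 hn), hgn]
    intro y hy
    rw [← Subalgebra.mem_toSubmodule, toSubmodule_groupAlgebra] at hy
    induction hy using Submodule.span_induction with
    | zero => simp
    | add u v _ _ hu hv => rw [map_add]; exact add_mem hu hv
    | smul r u _ hu => rw [map_smul]; exact Subalgebra.smul_mem _ hu r
    | mem u hu =>
      obtain ⟨i, rfl⟩ := hu
      have : HopfAlgebra.antipode k (g ^ i) = HopfAlgebra.antipode k g ^ i := by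
        refine left_inv_eq_right_inv (hgl.pow (n := i)).antipode_mul_cancel ?_
        rw [← (hg _).mul_pow, hgl.mul_antipode_cancel, one_pow]
      change HopfAlgebra.antipode k (g ^ i) ∈ _
      rw [this, hS]
      exact pow_mem (pow_mem (Algebra.self_mem_adjoin_singleton k g) _) _
  adjointLeft_mem := by
    intro h y hy
    have : adjointLeft (k := k) h y = y * algebraMap k A (counit h) := by
      rw [← HopfAlgebra.mul_antipode_lTensor_comul_apply, adjointLeft]
      induction comul (R := k) h with
      | zero => simp
      | add u v hu hv => simp only [map_add, mul_add, hu, hv]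
      | tmul a b =>
        simp [← mul_assoc, (commute_of_mem_groupAlgebra hg hy a).eq]
    rw [this]
    exact mul_mem hy (Subalgebra.algebraMap_mem _ _)
  adjointRight_mem := by
    intro h y hy
    have : adjointRight (k := k) h y = y * algebraMap k A (counit h) := by
      rw [← HopfAlgebra.mul_antipode_rTensor_comul_apply, adjointRight]
      induction comul (R := k) h with
      | zero => simp
      | add u v hu hv => simp only [map_add, mul_add, hu, hv]
      | tmul a b =>
        simp [← mul_assoc, (commute_of_mem_groupAlgebra hg hy _).eq]
    rw [this]
    exact mul_mem hy (Subalgebra.algebraMap_mem _ _)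

/-- For a group-like element `g`, the ideal `A⟨g⟩⁺` is generated by `g - 1`. -/
theorem augmentationIdeal_groupAlgebra {g : A} (hgl : IsGroupLikeElem k g) :
    augmentationIdeal (k := k) (groupAlgebra k g) = Ideal.span {g - 1} := by
  apply le_antisymm
  · have key : ∀ y ∈ groupAlgebra k g, y - algebraMap k A (counit y) ∈ Ideal.span {g - 1} := by
      intro y hy
      induction hy using Algebra.adjoin_induction with
      | mem u hu =>
        rw [Set.mem_singleton_iff.1 hu, hgl.counit_eq_one, map_one]
        exact Ideal.subset_span rfl
      | algebraMap r => simp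
      | add u v _ _ hu hv =>
        rw [map_add, map_add, add_sub_add_comm]
        exact add_mem hu hv
      | mul u v _ _ hu hv =>
        rw [Bialgebra.counit_mul, map_mul]
        have : u * v - algebraMap k A (counit u) * algebraMap k A (counit v) =
            u * (v - algebraMap k A (counit v)) +
              algebraMap k A (counit v) * (u - algebraMap k A (counit u)) := by
          rw [mul_sub, mul_sub, ← Algebra.commutes _ u, ← Algebra.commutes _ (algebraMap k A _)]
          abel
        rw [this]
        exact add_mem (Ideal.mul_mem_left _ _ hv) (Ideal.mul_mem_left _ _ hu)
    refine Ideal.span_le.2 ?_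
    rintro y ⟨hy, hy0⟩
    simpa [hy0] using key y hy
  · refine Ideal.span_le.2 ?_
    rintro _ rfl
    refine Ideal.subset_span ⟨sub_mem (Algebra.self_mem_adjoin_singleton k g) (one_mem _), ?_⟩
    rw [map_sub, hgl.counit_eq_one, Bialgebra.counit_one, sub_self]

theorem isTwoSided_span_sub_one {g : A} (hg : ∀ a, Commute g a) :
    (Ideal.span {g - 1}).IsTwoSided where
  mul_mem_of_left := by
    intro a b ha
    obtain ⟨d, rfl⟩ := Ideal.mem_span_singleton'.1 ha
    rw [mul_assoc, ((hg b).sub_left (Commute.one_left b)).eq, ← mul_assoc]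
    exact Ideal.mul_mem_left _ _ (Ideal.subset_span rfl)

theorem isHopfIdeal_span_sub_one {g : A} (hg : ∀ a, Commute g a) (hgl : IsGroupLikeElem k g) :
    (Ideal.span {g - 1}).IsHopfIdeal k where
  counit_eq_zero := by
    intro a ha
    obtain ⟨d, rfl⟩ := Ideal.mem_span_singleton'.1 ha
    rw [Bialgebra.counit_mul, map_sub, hgl.counit_eq_one, Bialgebra.counit_one, sub_self, mul_zero]
  map_mkQ_comul_eq_zero := by
    have := isTwoSided_span_sub_one hg
    let π := Ideal.Quotient.mkₐ k (Ideal.span {g - 1})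
    have hπg : π g = 1 := by
      rw [← sub_eq_zero, ← map_one π, ← map_sub]
      exact Ideal.Quotient.eq_zero_iff_mem.2 (Ideal.subset_span rfl)
    intro a ha
    obtain ⟨d, rfl⟩ := Ideal.mem_span_singleton'.1 ha
    change Algebra.TensorProduct.map π π (comul (R := k) (d * (g - 1))) = 0
    rw [Bialgebra.comul_mul, map_mul, map_sub, hgl.comul_eq_tmul_self, Bialgebra.comul_one,
      map_sub, map_one, Algebra.TensorProduct.map_tmul, hπg, Algebra.TensorProduct.one_def,
      sub_self, mul_zero]
  antipode_mem := by
    intro a ha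
    obtain ⟨d, rfl⟩ := Ideal.mem_span_singleton'.1 ha
    rw [HopfAlgebra.antipode_mul_antidistrib, map_sub, HopfAlgebra.antipode_one]
    have := isTwoSided_span_sub_one hg
    refine Ideal.mul_mem_right _ _ (Ideal.mem_span_singleton'.2 ⟨-HopfAlgebra.antipode k g, ?_⟩)
    rw [mul_sub, mul_one, neg_mul, hgl.antipode_mul_cancel]
    abel

/-- The quotient of a quasitriangular Hopf algebra with surjective `f_Q`, `Q = R₂₁ R`, by a central
group-like element as in `bijective_evalLeft_quotient` is factorizable. -/
theorem exists_isFactorizable_quotient [CharZero k] [FiniteDimensional k A] {n : ℕ} (hn : n ≠ 0)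
    {g : A} (hg : ∀ a, Commute g a) (hgl : IsGroupLikeElem k g) (hgn : g ^ n = 1) {R : A ⊗[k] A}
    (hR : IsQuasitriangular k R)
    (hQ : Function.Surjective (evalLeft k (TensorProduct.comm k A A R * R)))
    (η : Module.Dual k A) (hη : ∀ p, evalLeft k (TensorProduct.comm k A A R * R) (convLeft η p) =
      g * evalLeft k (TensorProduct.comm k A A R * R) p)
    {ζ : k} (hζ : IsPrimitiveRoot ζ n) (hηg : ∀ a, η (a * g) = ζ * η a) :
    ∃ (_ : (augmentationIdeal (k := k) (groupAlgebra k g)).IsTwoSided)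
      (_ : (augmentationIdeal (k := k) (groupAlgebra k g)).IsHopfIdeal k),
      IsFactorizable k (quotientR k (augmentationIdeal (groupAlgebra k g)) R) := by
  rw [augmentationIdeal_groupAlgebra hgl]
  have := isTwoSided_span_sub_one hg
  have := isHopfIdeal_span_sub_one hg hgl
  refine ⟨‹_›, ‹_›, hR.map (Ideal.Quotient.mkₐ k (Ideal.span {g - 1}))
    Ideal.Quotient.mk_surjective (fun _ => rfl), ?_⟩
  have h1 : TensorProduct.comm k _ _ (quotientR k (Ideal.span {g - 1}) R) *
      quotientR k (Ideal.span {g - 1}) R =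
      quotientR k (Ideal.span {g - 1}) (TensorProduct.comm k A A R * R) := by
    change TensorProduct.comm k _ _ (Algebra.TensorProduct.map _ _ R) *
      Algebra.TensorProduct.map _ _ R = Algebra.TensorProduct.map (Ideal.Quotient.mkₐ k _)
        (Ideal.Quotient.mkₐ k _) _
    rw [comm_map_apply, map_mul]
  rw [h1]
  exact bijective_evalLeft_quotient hn hgl hgn _ rfl hQ η hη hζ hηg

end Central

/-! ### The map `f_Q` of the Drinfeld double -/

section ComulAction
variable (k : Type*) {H : Type*} [Field k] [Ring H] [HopfAlgebra k H]

/-- `h ↦ ∑ χ(h₍₁₎) h₍₂₎`. -/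
noncomputable def comulLeft (χ : HopfDual k H) : H →ₗ[k] H :=
  (TensorProduct.lid k H).toLinearMap ∘ₗ LinearMap.rTensor H χ.ofConv ∘ₗ comul

/-- `h ↦ ∑ h₍₁₎ χ(h₍₂₎)`. -/
noncomputable def comulRight (χ : HopfDual k H) : H →ₗ[k] H :=
  (TensorProduct.rid k H).toLinearMap ∘ₗ LinearMap.lTensor H χ.ofConv ∘ₗ comul

theorem comulLeft_eq (χ : HopfDual k H) {h : H} {κ : Type*} (r : Coalgebra.Repr k h κ) :
    comulLeft k χ h = ∑ s ∈ r.index, χ (r.left s) • r.right s := by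
  simp [comulLeft, ← r.eq]

theorem comulRight_eq (χ : HopfDual k H) {h : H} {κ : Type*} (r : Coalgebra.Repr k h κ) :
    comulRight k χ h = ∑ s ∈ r.index, χ (r.right s) • r.left s := by
  simp [comulRight, ← r.eq]

theorem apply_comulLeft (χ f : HopfDual k H) (h : H) : f (comulLeft k χ h) = (χ * f) h := by
  rw [comulLeft_eq k χ (ℛ k h), (ℛ k h).convMul_apply]
  simp

theorem apply_comulRight (χ f : HopfDual k H) (h : H) : f (comulRight k χ h) = (f * χ) h := by
  rw [comulRight_eq k χ (ℛ k h), (ℛ k h).convMul_apply]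
  simp [mul_comm]

end ComulAction

section DoubleMap
variable (k : Type*) {H : Type*} [Field k] [Ring H] [HopfAlgebra k H] [FiniteDimensional k H]

instance : FiniteDimensional k (DrinfeldDouble k H) :=
  Module.Finite.equiv (toDouble k H)

variable {ι : Type*} [Fintype ι] (b : Module.Basis ι k H)

variable {k} in
/-- `f_Q(p) = ∑ᵢⱼ p(hⁱ hⱼ) hᵢ hʲ`. -/
theorem evalLeft_universalR (p : Module.Dual k (DrinfeldDouble k H)) :
    evalLeft k (TensorProduct.comm k _ _ (universalR k H) * universalR k H) p =
      ∑ i, ∑ j, p (of (toConv (b.coord i)) (b j)) •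
        (of 1 (b i) * of (toConv (b.coord j)) 1) := by
  rw [universalR_eq b]
  have hlin : ∀ u : ι → ι → DrinfeldDouble k H ⊗[k] DrinfeldDouble k H,
      evalLeft k (∑ i, ∑ j, u i j) p = ∑ i, ∑ j, evalLeft k (u i j) p := by
    intro u
    simp [evalLeft]
  simp only [map_sum, TensorProduct.comm_tmul]
  rw [Finset.sum_mul_sum, hlin]
  simp only [Algebra.TensorProduct.tmul_mul_tmul, evalLeft_tmul, of_mul_one_of, one_mul]

/-- The Drinfeld double is factorizable: `f_Q` amounts to the multiplication map
`H ⊗ H* → D(H)`, which is onto because the antipode of `D(H)` is. -/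
theorem evalLeft_universalR_surjective : Function.Surjective
    (evalLeft k (TensorProduct.comm k _ _ (universalR k H) * universalR k H)) := by
  rw [← LinearMap.range_eq_top, eq_top_iff]
  rintro d -
  obtain ⟨d, rfl⟩ := (antipode_bijective k).2 d
  obtain ⟨d, rfl⟩ := (toDouble k H).surjective d
  induction d with
  | zero => simp
  | add u v hu hv => rw [map_add, map_add]; exact add_mem hu hv
  | tmul f h =>
    let b := Module.finBasis k H
    have h1 : HopfAlgebra.antipode k (toDouble k H (f ⊗ₜ h)) = of 1 (HopfAlgebra.antipode k h) *
      of (antipodeDual k H f) 1 := doubleAntipode_of f h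
    generalize HopfAlgebra.antipode k h = a at h1
    generalize antipodeDual k H f = g at h1
    -- The functional `f' h' ↦ f'(a) g(h')` is mapped to `a g`.
    let p : Module.Dual k (DrinfeldDouble k H) :=
      g.ofConv ∘ₗ evalDual k a ∘ₗ (toDouble k H).symm.toLinearMap
    have hp : ∀ f h, p (of f h) = f a * g h := by
      intro f h
      change g (evalDual k a (f ⊗ₜ h)) = _
      simp
    refine ⟨p, ?_⟩
    rw [evalLeft_universalR b, h1]
    simp only [hp, ← smul_mul_smul_comm]
    rw [← Finset.sum_mul_sum]
    congr 1
    · have := congrArg (inclRight k H) (sum_coord_smul b a)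
      simpa only [map_sum, map_smul] using! this
    · have := congrArg (inclLeft k H) (sum_apply_smul_coord k b g)
      simpa only [map_sum, map_smul] using! this

theorem sum_comulLeft (χ : HopfDual k H) :
    ∑ i, toConv (b.coord i) ⊗ₜ[k] comulLeft k χ (b i) =
      ∑ i, (χ * toConv (b.coord i)) ⊗ₜ[k] b i := by
  refine evalDual_ext k fun y => ?_
  simp only [map_sum, evalDual_tmul]
  rw [sum_mul_coord_smul b χ y (ℛ k y), ← comulLeft_eq]
  conv_rhs => rw [← sum_coord_smul b y]
  simp only [map_sum, map_smul]

/-- The functional `f h ↦ f(x) χ(h)` on the Drinfeld double. -/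
noncomputable def doubleFunctional (χ : HopfDual k H) (x : H) :
    Module.Dual k (DrinfeldDouble k H) :=
  χ.ofConv ∘ₗ evalDual k x ∘ₗ (toDouble k H).symm.toLinearMap

theorem doubleFunctional_of (χ f : HopfDual k H) (x h : H) :
    doubleFunctional k χ x (of f h) = f x * χ h := by
  change χ (evalDual k x (f ⊗ₜ h)) = _
  simp

/-- As `Δ(f h) = ∑ f₍₂₎ h₍₁₎ ⊗ f₍₁₎ h₍₂₎`, convolution with `f h ↦ f(x) χ(h)` is the transpose of
`f h ↦ (x ⇀ f) (∑ χ(h₍₁₎) h₍₂₎)`. -/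
theorem convLeft_doubleFunctional_of (χ f : HopfDual k H) (x h : H)
    (p : Module.Dual k (DrinfeldDouble k H)) :
    convLeft (doubleFunctional k χ x) p (of f h) = p (of (leftHit k x f) (comulLeft k χ h)) := by
  have hf : leftHit k x f = TensorProduct.rid k _ (LinearMap.lTensor (HopfDual k H)
      (LinearMap.applyₗ x ∘ₗ (WithConv.linearEquiv k (H →ₗ[k] k)).toLinearMap)
        (comulDual k H f)) := by
    ext y
    rw [leftHit_apply, ← evalDual_comulDual]
    induction comulDual k H f with
    | zero => simp
    | add u v hu hv => simp only [map_add, ofConv_add, LinearMap.add_apply, hu, hv]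
    | tmul u v => simp [mul_comm]
  rw [convLeft_apply, comul_of, hf, comulLeft]
  simp only [LinearMap.comp_apply, LinearEquiv.coe_coe]
  let P : HopfDual k H ⊗[k] H →ₗ[k] k := p ∘ₗ (toDouble k H).toLinearMap
  change _ = P (_ ⊗ₜ _)
  have hP : ∀ f h, p (of f h) = P (f ⊗ₜ h) := fun _ _ => rfl
  induction comulDual k H f with
  | zero => simp
  | add u v hu hv =>
    simp only [map_add, LinearMap.add_apply, TensorProduct.add_tmul, hu, hv]
  | tmul u v =>
  induction comul (R := k) h with
  | zero => simp
  | add u v hu hv => simp only [map_add, TensorProduct.tmul_add, hu, hv]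
  | tmul c d =>
    simp [doubleFunctional_of, hP, ← TensorProduct.smul_tmul', mul_assoc, mul_left_comm]

/-- When `χ x` is central, convolution with the functional `f h ↦ f(x) χ(h)` corresponds under
`f_Q` to multiplication by `χ x = f_Q(f h ↦ f(x) χ(h))`. -/
theorem evalLeft_convLeft_doubleFunctional (χ : HopfDual k H) (x : H)
    (hc : ∀ d : DrinfeldDouble k H, Commute (of χ x) d)
    (hx : of 1 x * of χ 1 = of χ x) (p : Module.Dual k (DrinfeldDouble k H)) :
    evalLeft k (TensorProduct.comm k _ _ (universalR k H) * universalR k H)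
      (convLeft (doubleFunctional k χ x) p) = of χ x *
      evalLeft k (TensorProduct.comm k _ _ (universalR k H) * universalR k H) p := by
  let b := Module.finBasis k H
  rw [evalLeft_universalR b, evalLeft_universalR b]
  simp only [convLeft_doubleFunctional_of]
  let P : HopfDual k H →ₗ[k] H →ₗ[k] k :=
    TensorProduct.curry (p ∘ₗ (toDouble k H).toLinearMap)
  have hP : ∀ f h, p (of f h) = P f h := fun _ _ => rfl
  have h1 : ∀ (h : H) (d : DrinfeldDouble k H),
      ∑ i, p (of (leftHit k x (toConv (b.coord i))) h) • (of 1 (b i) * d) =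
      ∑ i, p (of (toConv (b.coord i)) h) • (of 1 (b i * x) * d) := by
    intro h d
    have := congrArg ((TensorProduct.lid k _).toLinearMap ∘ₗ TensorProduct.map (P.flip h ∘ₗ
      (LinearMap.id)) (LinearMap.mulRight k d ∘ₗ inclRight k H)) (sum_leftHit_coord b x)
    simpa only [map_sum] using! this
  have h2 : ∀ (f : HopfDual k H) (d : DrinfeldDouble k H),
      ∑ j, p (of f (comulLeft k χ (b j))) • (d * of (toConv (b.coord j)) 1) =
      ∑ j, p (of f (b j)) • (d * of (χ * toConv (b.coord j)) 1) := by
    intro f d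
    have := congrArg ((TensorProduct.rid k _).toLinearMap ∘ₗ TensorProduct.map
      (LinearMap.mulLeft k d ∘ₗ inclLeft k H) (P f)) (sum_comulLeft k b χ)
    simpa only [map_sum] using! this
  simp only [h2]
  rw [Finset.sum_comm]
  simp only [h1]
  rw [Finset.sum_comm]
  simp only [Finset.mul_sum, mul_smul_comm]
  refine Finset.sum_congr rfl fun i _ => Finset.sum_congr rfl fun j _ => ?_
  congr 1
  rw [← of_mul_one_of, ← of_one_mul_of, mul_assoc, ← mul_assoc (of 1 x), hx, ← mul_assoc,
    ← (hc _).eq, mul_assoc]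

variable {k} in
theorem dual_groupLike_mul {χ : HopfDual k H} (hχ : IsGroupLikeElem k χ) (y z : H) :
    χ (y * z) = χ y * χ z := by
  rw [← evalDual_comulDual, ← comul_dual_def, hχ.comul_eq_tmul_self]
  simp

/-- When `χ x` is central, right translation by it scales the functional `f h ↦ f(x) χ(h)` by
`χ(x) ^ 2`: one factor comes from `(f χ)(x)`, the other from `χ(x h)`. -/
theorem doubleFunctional_mul (χ : HopfDual k H) (hχ : IsGroupLikeElem k χ) (x : H)
    (hx : IsGroupLikeElem k x) (hc : ∀ d : DrinfeldDouble k H, Commute (of χ x) d)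
    (d : DrinfeldDouble k H) :
    doubleFunctional k χ x (d * of χ x) = χ x ^ 2 * doubleFunctional k χ x d := by
  obtain ⟨d, rfl⟩ := (toDouble k H).surjective d
  induction d with
  | zero => simp
  | add u v hu hv => simp only [map_add, add_mul, mul_add, hu, hv]
  | tmul f h =>
    have h1 : of f h * of χ x = of (f * χ) (x * h) := by
      rw [← mul_one f, ← one_mul h, ← of_one_mul_of, one_mul, mul_one, mul_assoc, ← (hc _).eq,
        of_mul_one_of, of_one_mul_of]
    change doubleFunctional k χ x (of f h * of χ x) = χ x ^ 2 * doubleFunctional k χ x (of f h)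
    rw [h1, doubleFunctional_of, doubleFunctional_of, dual_groupLike_mul hχ,
      LinearMap.convMul_apply, hx.comul_eq_tmul_self]
    simp
    ring

end DoubleMap

/-! ### Central group-like elements of the Drinfeld double -/

section CentralGroupLike
variable {k H : Type*} [Field k] [Ring H] [HopfAlgebra k H] [FiniteDimensional k H]

theorem isGroupLikeElem_of {χ : HopfDual k H} (hχ : IsGroupLikeElem k χ) {x : H}
    (hx : IsGroupLikeElem k x) : IsGroupLikeElem k (of χ x) where
  counit_eq_one := by
    rw [counit_of, hx.counit_eq_one, ← counit_dual_def, hχ.counit_eq_one, mul_one]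
  comul_eq_tmul_self := by
    rw [comul_of, ← comul_dual_def, hχ.comul_eq_tmul_self, hx.comul_eq_tmul_self]
    rfl

/-- The tautological representation `Δ(x) = x ⊗ x`. -/
noncomputable def groupLikeRepr {x : H} (hx : IsGroupLikeElem k x) : Coalgebra.Repr k x Unit where
  index := {()}
  left _ := x
  right _ := x
  eq := by simp [hx.comul_eq_tmul_self]

/-- For group-like `x` the exchange relation reads `x f = (x ⇀ f ↼ x⁻¹) x`. -/
theorem one_of_mul_of_one_groupLike {x : H} (hx : IsGroupLikeElem k x) (f : HopfDual k H) :
    of 1 x * of f 1 = of (leftHit k x (rightHit k (HopfAlgebra.antipode k x) f)) x := by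
  have h1 := exchange k x (groupLikeRepr hx) (rightHit k (HopfAlgebra.antipode k x) f)
  have h2 : rightHit k x (rightHit k (HopfAlgebra.antipode k x) f) = f := by
    ext y
    simp [← mul_assoc, hx]
  simpa [groupLikeRepr, h2] using h1

/-- For group-like `χ` the exchange relation reads `∑ h₍₁₎ χ(h₍₂₎) χ = ∑ χ(h₍₁₎) χ h₍₂₎`. -/
theorem one_of_comulRight_mul {χ : HopfDual k H} (hχ : IsGroupLikeElem k χ) (h : H) :
    of 1 (comulRight k χ h) * of χ 1 = of χ (comulLeft k χ h) := by
  have h1 := exchange k h (ℛ k h) χ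
  have h2 : ∀ y, rightHit k y χ = χ y • χ := by
    intro y; ext z; simp [dual_groupLike_mul hχ]
  have h3 : ∀ y, leftHit k y χ = χ y • χ := by
    intro y; ext z; simp [dual_groupLike_mul hχ, mul_comm]
  simp only [h2, h3] at h1
  rw [comulRight_eq k χ (ℛ k h), comulLeft_eq k χ (ℛ k h)]
  have h4 : ∀ (c : k) (f : HopfDual k H) (h : H), of (c • f) h = c • of f h :=
    fun c f h => TensorProduct.smul_tmul' c f h
  simp only [h4, mul_smul_comm] at h1
  simp only [← inclRight_apply, map_sum, map_smul, Finset.sum_mul, smul_mul_assoc] at h1 ⊢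
  rw [h1]
  have := map_sum ((toDouble k H).toLinearMap ∘ₗ TensorProduct.mk k _ _ χ)
        (fun s => χ ((ℛ k h).left s) • (ℛ k h).right s) (ℛ k h).index
  simp only [map_smul] at this
  exact this.symm

/-- `χ x` is central in the Drinfeld double as soon as it commutes with `H*`, that is, as soon
as `χ * (x ⇀ f ↼ x⁻¹) = f * χ` for all `f`. -/
theorem commute_of_of_forall {χ : HopfDual k H} (hχ : IsGroupLikeElem k χ) (hu : IsUnit χ) {x : H}
    (hx : IsGroupLikeElem k x)
    (h : ∀ f, χ * leftHit k x (rightHit k (HopfAlgebra.antipode k x) f) = f * χ)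
    (d : DrinfeldDouble k H) : Commute (of χ x) d := by
  have hdual : ∀ y z : H, (∀ f : HopfDual k H, f y = f z) → y = z := by
    intro y z hyz
    rw [← sub_eq_zero, ← Module.forall_dual_apply_eq_zero_iff k]
    intro f
    rw [map_sub, sub_eq_zero]
    exact hyz (toConv f)
  have hleft : ∀ f, of χ x * of f 1 = of f 1 * of χ x := by
    intro f
    rw [← one_mul x, ← of_mul_one_of, mul_assoc, one_of_mul_of_one_groupLike hx, of_one_mul_of,
      h, of_mul_one_of, one_mul, of_one_mul_of]
  have hcomul : ∀ y, comulLeft k χ y * x = x * comulRight k χ y := by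
    intro y
    have h1 : HopfAlgebra.antipode k x * comulLeft k χ y * x = comulRight k χ y := by
      refine hdual _ _ fun f => ?_
      rw [apply_comulRight, ← h, ← apply_comulLeft]
      simp [mul_assoc]
    rw [← h1, ← mul_assoc, ← mul_assoc, hx.mul_antipode_cancel, one_mul]
  -- `y ↦ ∑ y₍₁₎ χ(y₍₂₎)` is the transpose of `f ↦ f * χ`, which is onto as `χ` is invertible.
  have hsurj : Function.Surjective (comulRight k χ) := by
    refine LinearMap.injective_iff_surjective.1 ((injective_iff_map_eq_zero _).2 fun y hy => ?_)
    refine hdual _ _ fun f => ?_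
    obtain ⟨u, rfl⟩ := hu
    have := apply_comulRight k (u : HopfDual k H) (f * (u⁻¹ : (HopfDual k H)ˣ)) y
    rw [hy, mul_assoc, Units.inv_mul, mul_one] at this
    rw [← this, map_zero, map_zero]
  have hright : ∀ y, of χ x * of 1 y = of 1 y * of χ x := by
    intro y
    obtain ⟨y, rfl⟩ := hsurj y
    rw [of_mul_one_of, ← hcomul, ← of_mul_one_of, ← one_of_comulRight_mul hχ, mul_assoc,
      of_mul_one_of, one_mul]
  obtain ⟨d, rfl⟩ := (toDouble k H).surjective d
  induction d with
  | zero => simp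
  | add u v hu hv => rw [map_add]; exact hu.add_right hv
  | tmul f y =>
    rw [show toDouble k H (f ⊗ₜ y) = of f 1 * of 1 y by rw [of_mul_one_of, one_mul]; rfl]
    exact Commute.mul_right (hleft f) (hright y)

theorem of_dual_pow (f : HopfDual k H) (i : ℕ) : of f (1 : H) ^ i = of (f ^ i) 1 := by
  induction i with
  | zero => simp [one_def]
  | succ i ih => rw [pow_succ, ih, of_one_mul_of, pow_succ]

theorem of_one_pow (h : H) (i : ℕ) : of (1 : HopfDual k H) h ^ i = of 1 (h ^ i) := by
  induction i with
  | zero => simp [one_def]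
  | succ i ih => rw [pow_succ, ih, of_mul_one_of, pow_succ]

end CentralGroupLike

/-- Under hypotheses (i) and (ii) the relation `χ * (x ⇀ f ↼ x⁻¹) = f * χ` holds on the dual basis:
conjugation by `x` permutes the basis through `σ`, and associativity of `χ * E * χ` shows that `σ`
and `τ` commute. -/
theorem convMul_conj_eq {k H : Type*} [Field k] [Ring H] [HopfAlgebra k H] [FiniteDimensional k H]
    {n m : ℕ} {x : H} (hx : IsGroupLikeElem k x) {a : Fin m → H} {χ : HopfDual k H}
    (hχx : χ x ≠ 0) {σ τ : Equiv.Perm (Fin m)} (hσ : ∀ i, x * a i = a (σ i) * x)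
    (B : Module.Basis (Fin m × Fin n) k H) (hB : ∀ i j, B (i, j) = a i * x ^ (j.val + 1))
    (hχE : ∀ i j, χ * toConv (B.coord (i, j)) =
      (χ x) ^ (j.val + 1) • toConv (B.coord (τ i, j)))
    (hEχ : ∀ i j, toConv (B.coord (i, j)) * χ =
      (χ x) ^ (j.val + 1) • toConv (B.coord (σ (τ i), j))) (f : HopfDual k H) :
    χ * leftHit k x (rightHit k (HopfAlgebra.antipode k x) f) = f * χ := by
  have hconj : ∀ l, HopfAlgebra.antipode k x * B l * x = B (σ.symm l.1, l.2) := by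
    rintro ⟨i, j⟩
    rw [hB, hB]
    have h1 : HopfAlgebra.antipode k x * a i * x = a (σ.symm i) := by
      have := hσ (σ.symm i)
      rw [Equiv.apply_symm_apply] at this
      rw [mul_assoc, ← this, ← mul_assoc, hx.antipode_mul_cancel, one_mul]
    rw [← h1, mul_assoc, mul_assoc, ← pow_succ, pow_succ']
    simp only [mul_assoc]
  have hcoord : ∀ i j, leftHit k x (rightHit k (HopfAlgebra.antipode k x)
      (toConv (B.coord (i, j)))) = toConv (B.coord (σ i, j)) := by
    intro i j
    apply WithConv.ext
    refine B.ext fun l => ?_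
    rw [leftHit_apply, rightHit_apply, ← mul_assoc, hconj]
    simp only [Module.Basis.coord_apply, Module.Basis.repr_self]
    rw [Finsupp.single_apply, Finsupp.single_apply]
    simp [Prod.ext_iff, Equiv.symm_apply_eq]
  have hcomm : ∀ i j, toConv (B.coord (τ (σ i), j)) = (toConv (B.coord (σ (τ i), j)) :
      HopfDual k H) := by
    intro i j
    have h1 := mul_assoc χ (toConv (B.coord (τ.symm i, j))) χ
    rw [hχE, hEχ, smul_mul_assoc, mul_smul_comm, hEχ, hχE, smul_smul, smul_smul,
      Equiv.apply_symm_apply] at h1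
    exact (smul_right_injective _ (mul_ne_zero (pow_ne_zero _ hχx) (pow_ne_zero _ hχx)) h1).symm
  conv_lhs => rw [← sum_apply_smul_coord k B f]
  conv_rhs => rw [← sum_apply_smul_coord k B f]
  simp only [map_sum, map_smul, Finset.mul_sum, Finset.sum_mul, mul_smul_comm, smul_mul_assoc]
  refine Finset.sum_congr rfl fun l _ => ?_
  obtain ⟨i, j⟩ := l
  rw [hcoord, hχE, hEχ, hcomm]

end HopfDouble

open HopfDouble
theorem corollary3p4 {k : Type*} [Field k] [IsAlgClosed k] [CharZero k]
    {H : Type*} [Ring H] [HopfAlgebra k H] [FiniteDimensional k H]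
    (n m : ℕ) (hn : Odd n)
    (x : H) (hx : IsGroupLikeElem k x) (hxn : orderOf x = n)
    (a : Fin m → H) (χ : HopfDual k H) (hχ : IsGroupLikeElem k χ)
    (σ τ : Equiv.Perm (Fin m))
    (hσ : ∀ i, x * a i = a (σ i) * x)
    (B : Module.Basis (Fin m × Fin n) k H)
    (hB : ∀ i j, B (i, j) = a i * x ^ (j.val + 1))
    (hχE : ∀ i j, χ * toConv (B.coord (i, j)) =
      (χ x) ^ (j.val + 1) • toConv (B.coord (τ i, j)))
    (hEχ : ∀ i j, toConv (B.coord (i, j)) * χ =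
      (χ x) ^ (j.val + 1) • toConv (B.coord (σ (τ i), j)))
    (hω : IsPrimitiveRoot (χ x) n) (hχn : orderOf χ = n) :
    IsGroupLikeElem k (DrinfeldDouble.of χ x) ∧
    IsNormalHopfSubalgebra (groupAlgebra k (DrinfeldDouble.of χ x)) ∧
    ∃ (_ : (augmentationIdeal (groupAlgebra k (DrinfeldDouble.of χ x))).IsTwoSided)
      (_ : (augmentationIdeal (groupAlgebra k (DrinfeldDouble.of χ x))).IsHopfIdeal k),
      IsFactorizable k (quotientR k
        (augmentationIdeal (groupAlgebra k (DrinfeldDouble.of χ x)))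
        (DrinfeldDouble.universalR k H)) := by
  have hn0 : n ≠ 0 := hn.pos.ne'
  have hχ1 : χ ^ n = 1 := hχn ▸ pow_orderOf_eq_one χ
  have hx1 : x ^ n = 1 := hxn ▸ pow_orderOf_eq_one x
  have hc : ∀ d, Commute (DrinfeldDouble.of χ x) d :=
    commute_of_of_forall hχ (IsUnit.of_pow_eq_one hχ1 hn0) hx
      (convMul_conj_eq hx (hω.ne_zero hn0) hσ B hB hχE hEχ)
  have hgl := isGroupLikeElem_of hχ hx
  have hfac : DrinfeldDouble.of χ x = DrinfeldDouble.of χ 1 * DrinfeldDouble.of 1 x := by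
    rw [of_mul_one_of, one_mul]
  -- `χ` is invertible and commutes with `χ x`, hence with `x`.
  have hswap : DrinfeldDouble.of 1 x * DrinfeldDouble.of χ 1 = DrinfeldDouble.of χ x := by
    have hunit : IsUnit (DrinfeldDouble.of χ (1 : H)) :=
      IsUnit.of_pow_eq_one (n := n) (by rw [of_dual_pow, hχ1, one_def]) hn0
    refine hunit.mul_left_cancel ?_
    rw [← mul_assoc, ← hfac, (hc _).eq]
  have hgn : DrinfeldDouble.of χ x ^ n = 1 := by
    rw [hfac, Commute.mul_pow (hfac.symm.trans hswap.symm), of_dual_pow, of_one_pow, hχ1, hx1,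
      ← one_def, one_mul]
  refine ⟨hgl, isNormalHopfSubalgebra_groupAlgebra hc hgl hn0 hgn, ?_⟩
  -- `n` is odd, so `χ(x) ^ 2` is still a primitive `n`-th root of unity.
  exact exists_isFactorizable_quotient hn0 hc hgl hgn (universalR_isQuasitriangular k)
    (evalLeft_universalR_surjective k) (doubleFunctional k χ x)
    (evalLeft_convLeft_doubleFunctional k χ x hc hswap)
    (hω.pow_of_coprime 2 (Nat.coprime_two_left.2 hn))
    (doubleFunctional_mul k χ hχ x hx hc)
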